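/- Let $A=\mathbb C^2/L$ be a two-dimensional complex torus (for example an Abelian surface). For a finite reduced crystallographic root system with a chosen base, let $\Lambda$ be its coroot lattice (the $\mathbb Z$-span of the coroots) and $W$ its Weyl group; $W$ acts on $\Lambda$, hence on $A\otimes\Lambda=A\otimes_{\mathbb Z}\Lambda$ and on $\mathbb C^2\otimes\Lambda$. A point $x$ of a complex analytic space $X$ is said to be locally modeled on a space $Y$ with base point $y$ if some open neighborhood of $x$ in $X$ is complex analytically isomorphic to an open neighborhood of $y$ in $Y$ by an isomorphism taking $x$ to $y$. (1) Suppose that the Dynkin diagram, of rank $l$, of a root system with coroot lattice $\Lambda$ and Weyl group $W$ is included as a full subdiagram in the Dynkin diagram, of rank $l+k$, of a root system with coroot lattice $\Lambda'$ and Weyl group $W'$. Let $p\in A\otimes\Lambda$ be any point and let $W_p\subset W$ be its stabilizer. Then there is a point $p'\in A\otimes\Lambda'$ whose $W'$-stabilizer is isomorphic to $W_p$ and such that the point $[p']\in (A\otimes\Lambda')/W'$ is locally modeled on $(\mathbb C^{2l}/W_p)\times\mathbb C^{2k}$ at its origin, where $W_p\subset W$ acts on $\mathbb C^{2l}\cong\mathbb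 C^2\otimes\Lambda$. (2) Consequently, for every irreducible root system whose Dynkin diagram is neither of type $A_n$ nor of type $C_n$ (i.e. the root system of any compact, simple, simply connected Lie group other than $SU(n)$ and $Sp(n)$), with coroot lattice $\Lambda$ and Weyl group $W$, there are integers $l>1$ and $k\ge 0$ with $l+k$ equal to the rank, and a point of $(A\otimes\Lambda)/W$ that is locally modeled on $(\mathbb C^{2l}/\{\pm1\})\times\mathbb C^{2k}$ at its origin. -/

import Mathlib

open scoped TensorProduct Topology

noncomputable section

/-! ### Dynkin diagrams -/

/-- An inclusion of the Dynkin diagram of `b` into that of `b'`, i.e. an identification of the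
former with the full subdiagram of the latter on a set of vertices (edges, multiplicities and
arrows being encoded by the Cartan matrix). -/
structure DynkinInclusion {ι M N ι' M' N' : Type*}
    [AddCommGroup M] [Module ℝ M] [AddCommGroup N] [Module ℝ N]
    [AddCommGroup M'] [Module ℝ M'] [AddCommGroup N'] [Module ℝ N']
    {P : RootPairing ι ℝ M N} [P.IsCrystallographic] (b : P.Base)
    {P' : RootPairing ι' ℝ M' N'} [P'.IsCrystallographic] (b' : P'.Base) where
  toEmbedding : b.support ↪ b'.support
  cartanMatrix_apply : ∀ i j,
    b'.cartanMatrix (toEmbedding i) (toEmbedding j) = b.cartanMatrix i j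

/-- The Dynkin diagram of `b` has Cartan matrix `C`, up to the numbering of its vertices. -/
def HasDynkinType {ι M N : Type*} [AddCommGroup M] [Module ℝ M] [AddCommGroup N] [Module ℝ N]
    {P : RootPairing ι ℝ M N} [P.IsCrystallographic] (b : P.Base) {n : ℕ}
    (C : Matrix (Fin n) (Fin n) ℤ) : Prop :=
  ∃ e : b.support ≃ Fin n, ∀ i j, b.cartanMatrix i j = C (e i) (e j)

/-! ### The coroot lattice and its Weyl group -/

section Lattice

variable {ι M N : Type*} [AddCommGroup M] [Module ℝ M] [AddCommGroup N] [Module ℝ N]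

/-- The coroot lattice `Λ`: the `ℤ`-span of the coroots. -/
abbrev CorootLattice (P : RootPairing ι ℝ M N) : Type _ := P.corootSpan ℤ

variable {P : RootPairing ι ℝ M N}

theorem coweightMap_mem_corootSpan (g : P.Aut) {x : N} (hx : x ∈ P.corootSpan ℤ) :
    g.coweightMap x ∈ P.corootSpan ℤ := by
  induction hx using Submodule.span_induction with
  | mem x hx =>
    obtain ⟨i, rfl⟩ := hx
    have h := congrFun g.coroot_coweightMap i
    simp only [Function.comp_apply] at h
    rw [h]
    exact Submodule.subset_span ⟨_, rfl⟩
  | zero => simp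
  | add x y _ _ hx hy => simpa using add_mem hx hy
  | smul a x _ hx => simpa using Submodule.smul_mem _ a hx

/-- The action of the Weyl group `W` on the coroot lattice. The reflection in the root `i` acts as
the coreflection `x ↦ x - ⟨root i, x⟩ • coroot i`. -/
def weylCorootRep (P : RootPairing ι ℝ M N) :
    P.weylGroup →* Module.End ℤ (CorootLattice P) where
  toFun w := AddMonoidHom.toIntLinearMap
    { toFun := fun x => ⟨(w⁻¹ : P.weylGroup).1.coweightMap x, coweightMap_mem_corootSpan _ x.2⟩
      map_zero' := by simp
      map_add' := fun x y => by ext; simp }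
  map_one' := by
    ext x
    change (((1 : P.weylGroup)⁻¹ : P.weylGroup).1.coweightMap (x : N)) = x
    rw [inv_one]
    rfl
  map_mul' v w := by
    ext x
    change (((v * w)⁻¹ : P.weylGroup).1.coweightMap (x : N)) =
      (v⁻¹ : P.weylGroup).1.coweightMap ((w⁻¹ : P.weylGroup).1.coweightMap (x : N))
    rw [mul_inv_rev]
    rfl

/-- The action of `W` on `B ⊗ Λ` induced by its action on `Λ`. -/
instance weylTensorAction (B : Type*) [AddCommGroup B] :
    MulAction P.weylGroup (B ⊗[ℤ] CorootLattice P) where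
  smul w t := (weylCorootRep P w).lTensor B t
  one_smul t := by
    change (weylCorootRep P 1).lTensor B t = t
    rw [map_one]
    exact LinearMap.lTensor_id_apply B (CorootLattice P) t
  mul_smul v w t := by
    change (weylCorootRep P (v * w)).lTensor B t =
      (weylCorootRep P v).lTensor B ((weylCorootRep P w).lTensor B t)
    rw [map_mul]
    exact LinearMap.lTensor_comp_apply B _ _ t

end Lattice

/-! ### Spaces with a notion of holomorphic function -/

/-- A topology on `X` together with the functions that are holomorphic on each open subset: the
data of a (reduced) complex analytic space. -/
structure AnalyticStructure (X : Type*) where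
  top : TopologicalSpace X
  IsHol : Set X → (X → ℂ) → Prop

namespace AnalyticStructure

/-- A finite-dimensional complex vector space with its holomorphic functions. -/
def std (E : Type*) [NormedAddCommGroup E] [NormedSpace ℂ E] : AnalyticStructure E where
  top := inferInstance
  IsHol U g := DifferentiableOn ℂ g U

/-- The quotient structure: a set is open, and a function is holomorphic, if and only if its
pullback is. -/
def quotient {X Y : Type*} (S : AnalyticStructure X) (π : X → Y) : AnalyticStructure Y where
  top := S.top.coinduced π
  IsHol U g := S.IsHol (π ⁻¹' U) (g ∘ π)

/-- The product of a quotient `π : E → X` of a complex vector space and a complex vector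
space `F`: the product topology, and the functions whose pullback to `E × F` is holomorphic. -/
def quotientProd {E X : Type*} [NormedAddCommGroup E] [NormedSpace ℂ E] (π : E → X)
    (F : Type*) [NormedAddCommGroup F] [NormedSpace ℂ F] : AnalyticStructure (X × F) where
  top := @instTopologicalSpaceProd X F ((std E).quotient π).top inferInstance
  IsHol U g := DifferentiableOn ℂ (g ∘ Prod.map π id) (Prod.map π id ⁻¹' U)

/-- The point `x` of `X` is locally modeled on the point `y` of `Y`: there is an analytic
isomorphism (a homeomorphism matching the holomorphic functions on all open subsets) from an open
neighborhood of `x` onto an open neighborhood of `y` that takes `x` to `y`. -/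
def LocallyModeledOn {X Y : Type*} (S : AnalyticStructure X) (x : X)
    (T : AnalyticStructure Y) (y : Y) : Prop :=
  ∃ φ : @OpenPartialHomeomorph X Y S.top T.top,
    x ∈ φ.source ∧ φ x = y ∧
      ∀ V : Set Y, IsOpen[T.top] V → V ⊆ φ.target → ∀ g : Y → ℂ,
        (T.IsHol V g ↔ S.IsHol (φ.source ∩ φ ⁻¹' V) (g ∘ φ))

end AnalyticStructure

open AnalyticStructure

/-! ### The torus `A ⊗ Λ` and its quotient by `W` -/

/-- The plane `ℂ²`. -/
abbrev C2 : Type := Fin 2 → ℂ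

section Spaces

variable {ι M N : Type*} [AddCommGroup M] [Module ℝ M] [AddCommGroup N] [Module ℝ N]
  {P : RootPairing ι ℝ M N}

/-- The map `(ℂ²)^l → B ⊗ Λ`, `z ↦ ∑ q (z i) ⊗ αᵢ`, given by the basis of simple coroots `αᵢ`
of `Λ` and a homomorphism `q : ℂ² → B`. -/
def tensorCoord {B : Type*} [AddCommGroup B] (q : C2 →ₗ[ℤ] B) (b : P.Base)
    (z : b.support → C2) : B ⊗[ℤ] CorootLattice P :=
  ∑ i, q (z i) ⊗ₜ[ℤ] P.corootSpanMem ℤ i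

/-- The complex analytic structure of `(A ⊗ Λ) / W`, where `A = ℂ² / L`. Here
`A ⊗ Λ ≅ A^l` is a quotient of `(ℂ²)^l`. -/
def torusQuotient (L : Submodule ℤ C2) (b : P.Base) :
    AnalyticStructure (MulAction.orbitRel.Quotient P.weylGroup ((C2 ⧸ L) ⊗[ℤ] CorootLattice P)) :=
  ((std (b.support → C2)).quotient (tensorCoord L.mkQ b)).quotient (Quotient.mk _)

/-- The quotient map `ℂ^{2l} ≅ ℂ² ⊗ Λ → (ℂ² ⊗ Λ) / H` for a subgroup `H` of the Weyl group. -/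
def linearQuotientMap (b : P.Base) (H : Subgroup P.weylGroup) (z : b.support → C2) :
    MulAction.orbitRel.Quotient H (C2 ⊗[ℤ] CorootLattice P) :=
  Quotient.mk _ (tensorCoord LinearMap.id b z)

/-- The quotient map `ℂ^{2l} → ℂ^{2l} / ±1`. -/
def signQuotientMap (l : ℕ) (z : Fin l → C2) : MulAction.orbitRel.Quotient ℤˣ (Fin l → C2) :=
  Quotient.mk _ z

end Spaces

end

/-! In the basis of simple coroots, `A ⊗ Λ` is `(ℂ²)^n` modulo `L^n`, and `W` acts by integer
matrices. Two small vectors `u`, `v` give the same point of the quotient near `z` exactly when `w u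
= v` for some `w` fixing `z` modulo `L^n`. This holds because `L` is discrete and `W` is finite. So
the quotient is modeled near `[z]` on `ℂ^{2n} / W_z` (`torusQuotient_locallyModeledOn`).

For a subdiagram `J`, the parabolic subgroup `W_J` generated by its simple reflections is the Weyl
group of `J`. As a `W_J`-space, `ℂ² ⊗ Λ'` is the sum of the span of the coroots of `J` and a
complement fixed pointwise, spanned by the fundamental coweights outside `J`. Push `p` forward along
`Λ → Λ'` and add a generic vector of that fixed complement. Nothing outside `W_J` fixes the result:
the stabilizer of a dominant vector is generated by the simple reflections fixing it, and countably
many accidental coincidences modulo `L` are avoided (`exists_translate_stabilizer`). Inside `W_J`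
the translation changes nothing, so the stabilizer is `W_p`, and the complement supplies the factor
`ℂ^{2k}`.

For the second claim, a connected finite diagram that is neither `A` nor `C` contains `B₃`, `D₄` or
`G₂` (`IsFiniteCartan.exists_subdiagram_or`). These have rank at most 4, the rank of `L`, so the
coordinates of `z` can be halves of distinct members of a `ℤ`-basis of `L`. Then `w` fixes `z`
modulo `L` exactly when `w ≡ 1` modulo 2. In the three Weyl groups only `±1` satisfy this
congruence: an isometry congruent to 1 modulo 2 sends each vector of norm two to itself or its
negative (`eq_one_or_neg_one_of_congruent`). -/

noncomputable section

open AnalyticStructure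

/-! ### Quotients by groups of biholomorphisms -/

/-- A surjection whose fibres are orbits of holomorphic homeomorphisms. -/
structure IsHolQuotientMap {E X : Type*} [NormedAddCommGroup E] [NormedSpace ℂ E]
    (π : E → X) : Prop where
  surjective : Function.Surjective π
  exists_homeomorph : ∀ z z', π z = π z' →
    ∃ γ : E ≃ₜ E, Differentiable ℂ γ ∧ γ z = z' ∧ ∀ u, π (γ u) = π u

namespace IsHolQuotientMap

variable {E X : Type*} [NormedAddCommGroup E] [NormedSpace ℂ E] {π : E → X}

/-- Since `π ∘ γ = π`, the open set `γ⁻¹(U)` around a point of the saturation of `U` stays inside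
the saturation. -/
theorem preimage_image_isOpen (h : IsHolQuotientMap π) {U : Set E} (hU : IsOpen U) :
    IsOpen (π ⁻¹' (π '' U)) := by
  rw [isOpen_iff_mem_nhds]
  rintro z ⟨u, hu, huz⟩
  obtain ⟨γ, -, hγ, hπ⟩ := h.exists_homeomorph z u huz.symm
  have : γ ⁻¹' U ∈ 𝓝 z := (hU.preimage γ.continuous).mem_nhds (by simpa [hγ] using hu)
  filter_upwards [this] with y hy
  exact ⟨γ y, hy, hπ y⟩

theorem isOpen_image (h : IsHolQuotientMap π) {U : Set E} (hU : IsOpen U) :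
    IsOpen[((std E).quotient π).top] (π '' U) :=
  isOpen_coinduced.2 (h.preimage_image_isOpen hU)

theorem prodMap {F : Type*} [NormedAddCommGroup F] [NormedSpace ℂ F] (h : IsHolQuotientMap π) :
    IsHolQuotientMap (Prod.map π (id : F → F)) where
  surjective := h.surjective.prodMap Function.surjective_id
  exists_homeomorph := by
    rintro ⟨z, t⟩ ⟨z', t'⟩ heq
    simp only [Prod.map_apply, id, Prod.mk.injEq] at heq
    obtain ⟨γ, hγ, hz, hπ⟩ := h.exists_homeomorph z z' heq.1
    refine ⟨γ.prodCongr (Homeomorph.refl F), ?_, by simp [hz, heq.2], fun ⟨u, v⟩ ↦ by simp [hπ]⟩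
    exact (hγ.comp differentiable_fst).prodMk differentiable_snd

end IsHolQuotientMap

/-- The product topology agrees with the quotient topology because `π` is open, so its product with
the identity is again an open surjection. -/
theorem quotientProd_eq_quotient {E X : Type*} [NormedAddCommGroup E] [NormedSpace ℂ E]
    {π : E → X} (h : IsHolQuotientMap π) (F : Type*) [NormedAddCommGroup F] [NormedSpace ℂ F] :
    quotientProd π F = (std (E × F)).quotient (Prod.map π id) := by
  have htop : (quotientProd π F).top = ((std (E × F)).quotient (Prod.map π id)).top := by
    let tX : TopologicalSpace X := ((std E).quotient π).top
    have hc : Continuous π := continuous_coinduced_rng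
    have ho : IsOpenMap π := fun U hU ↦ h.isOpen_image hU
    have hq : Topology.IsQuotientMap (Prod.map π (id : F → F)) :=
      (ho.prodMap IsOpenMap.id).isQuotientMap (hc.prodMap continuous_id)
        (h.surjective.prodMap Function.surjective_id)
    exact hq.eq_coinduced
  unfold quotientProd AnalyticStructure.quotient at *
  simp only [AnalyticStructure.mk.injEq]
  exact ⟨htop, rfl⟩

/-- Two quotients are analytically isomorphic near base points as soon as a biholomorphism of the
covering spaces matches the two equivalence relations on a saturated open neighborhood. -/
theorem locallyModeledOn_of_biholomorphism {E₁ E₂ X Y : Type*}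
    [NormedAddCommGroup E₁] [NormedSpace ℂ E₁] [NormedAddCommGroup E₂] [NormedSpace ℂ E₂]
    {π : E₁ → X} {ρ : E₂ → Y} (hπ : IsHolQuotientMap π) (hρ : IsHolQuotientMap ρ)
    (A : E₂ ≃ₜ E₁) (hA : Differentiable ℂ A) (hA' : Differentiable ℂ A.symm)
    {U : Set E₂} (hU : IsOpen U) {e : E₂} (he : e ∈ U)
    (hsat : ∀ u ∈ U, ∀ v, ρ u = ρ v → v ∈ U)
    (hrel : ∀ u ∈ U, ∀ v ∈ U, π (A u) = π (A v) ↔ ρ u = ρ v) :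
    ((std E₁).quotient π).LocallyModeledOn (π (A e)) ((std E₂).quotient ρ) (ρ e) := by
  classical
  let tX : TopologicalSpace X := ((std E₁).quotient π).top
  let tY : TopologicalSpace Y := ((std E₂).quotient ρ).top
  have hcπ : Continuous π := continuous_coinduced_rng
  have hcρ : Continuous ρ := continuous_coinduced_rng
  -- Both maps are defined by choosing a representative in `U`; `hrel` makes the choice irrelevant.
  -- The default values are never used.
  let f : X → Y := fun x ↦ if h : ∃ u ∈ U, π (A u) = x then ρ h.choose else ρ e
  let g : Y → X := fun y ↦ if h : ∃ u ∈ U, ρ u = y then π (A h.choose) else π (A e)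
  have hf : ∀ u ∈ U, f (π (A u)) = ρ u := by
    intro u hu
    have h : ∃ v ∈ U, π (A v) = π (A u) := ⟨u, hu, rfl⟩
    simp only [f, dif_pos h]
    exact (hrel _ h.choose_spec.1 _ hu).1 h.choose_spec.2
  have hg : ∀ u ∈ U, g (ρ u) = π (A u) := by
    intro u hu
    have h : ∃ v ∈ U, ρ v = ρ u := ⟨u, hu, rfl⟩
    simp only [g, dif_pos h]
    exact (hrel _ h.choose_spec.1 _ hu).2 h.choose_spec.2
  have hoS : ∀ V : Set E₂, IsOpen V → IsOpen ((fun u ↦ π (A u)) '' V) := by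
    intro V hV
    have := hπ.isOpen_image (A.isOpenMap V hV)
    rwa [Set.image_image] at this
  have hoT : ∀ V : Set E₂, IsOpen V → IsOpen (ρ '' V) := fun V hV ↦ hρ.isOpen_image hV
  let φ : OpenPartialHomeomorph X Y :=
    { toFun := f
      invFun := g
      source := (fun u ↦ π (A u)) '' U
      target := ρ '' U
      map_source' := by rintro _ ⟨u, hu, rfl⟩; exact ⟨u, hu, (hf u hu).symm⟩
      map_target' := by rintro _ ⟨u, hu, rfl⟩; exact ⟨u, hu, (hg u hu).symm⟩
      left_inv' := by rintro _ ⟨u, hu, rfl⟩; simp only [hf u hu, hg u hu]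
      right_inv' := by rintro _ ⟨u, hu, rfl⟩; simp only [hf u hu, hg u hu]
      open_source := hoS U hU
      open_target := hoT U hU
      continuousOn_toFun := by
        rw [continuousOn_open_iff (hoS U hU)]
        intro V hV
        convert hoS (U ∩ ρ ⁻¹' V) (hU.inter (hV.preimage hcρ)) using 1
        ext x
        constructor
        · rintro ⟨⟨u, hu, rfl⟩, hx⟩
          exact ⟨u, ⟨hu, by simpa [hf u hu] using hx⟩, rfl⟩
        · rintro ⟨u, ⟨hu, hV⟩, rfl⟩
          exact ⟨⟨u, hu, rfl⟩, by simpa [hf u hu] using hV⟩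
      continuousOn_invFun := by
        rw [continuousOn_open_iff (hoT U hU)]
        intro V hV
        convert hoT (U ∩ (fun u ↦ π (A u)) ⁻¹' V)
          (hU.inter (hV.preimage (hcπ.comp A.continuous))) using 1
        ext x
        constructor
        · rintro ⟨⟨u, hu, rfl⟩, hx⟩
          exact ⟨u, ⟨hu, by simpa [hg u hu] using hx⟩, rfl⟩
        · rintro ⟨u, ⟨hu, hV⟩, rfl⟩
          exact ⟨⟨u, hu, rfl⟩, by simpa [hg u hu] using hV⟩ }
  refine ⟨φ, ⟨e, he, rfl⟩, hf e he, fun V hV hVT k ↦ ?_⟩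
  have hS : IsOpen (φ.source ∩ φ ⁻¹' V) := φ.isOpen_inter_preimage hV
  change DifferentiableOn ℂ (k ∘ ρ) (ρ ⁻¹' V) ↔
    DifferentiableOn ℂ ((k ∘ f) ∘ π) (π ⁻¹' (φ.source ∩ φ ⁻¹' V))
  constructor
  · rintro h z ⟨⟨u, hu, huz⟩, hzV⟩
    have huz' : π (A u) = π z := huz
    -- The point `z` need not lie in `A(U)`, only in its saturation; `γ` moves it there, where `f ∘
    -- π` is `ρ ∘ A⁻¹`.
    obtain ⟨γ, hγ, hγz, hγπ⟩ := hπ.exists_homeomorph z (A u) huz'.symm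
    have huV : ρ u ∈ V := by
      have : f (π z) ∈ V := hzV
      rwa [← huz', hf u hu] at this
    have h1 : DifferentiableAt ℂ (k ∘ ρ) (A.symm (γ z)) := by
      rw [hγz, A.symm_apply_apply]
      exact (h u huV).differentiableAt ((hV.preimage hcρ).mem_nhds huV)
    have h2 : DifferentiableAt ℂ (fun y ↦ (k ∘ ρ) (A.symm (γ y))) z :=
      DifferentiableAt.comp (f := fun y ↦ A.symm (γ y)) z h1
        (DifferentiableAt.comp (f := γ) z (hA' _) (hγ z))
    refine (h2.congr_of_eventuallyEq ?_).differentiableWithinAt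
    have h3 : (fun y ↦ A.symm (γ y)) ⁻¹' U ∈ 𝓝 z := by
      refine (hU.preimage (A.symm.continuous.comp γ.continuous)).mem_nhds ?_
      simpa [hγz] using hu
    filter_upwards [h3] with y hy
    have := hf _ hy
    simp only [A.apply_symm_apply, hγπ] at this
    simp [this]
  · intro h u hu
    obtain ⟨v, hv, hvu⟩ := hVT hu
    -- Saturation of `U` is needed here: every preimage of a point of the target lies in `U`.
    have huU : u ∈ U := hsat v hv u hvu
    have hmem : A u ∈ π ⁻¹' (φ.source ∩ φ ⁻¹' V) := by
      refine ⟨⟨u, huU, rfl⟩, ?_⟩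
      change f (π (A u)) ∈ V
      rw [hf u huU]
      exact hu
    have h1 := (h _ hmem).differentiableAt ((hS.preimage hcπ).mem_nhds hmem)
    have h2 := DifferentiableAt.comp u h1 (hA u)
    refine (h2.congr_of_eventuallyEq ?_).differentiableWithinAt
    filter_upwards [hU.mem_nhds huU] with y hy
    simp [hf y hy]

/-! ### Integer matrices acting on vectors with entries in an abelian group -/

section MatAct

variable {I J K V : Type*} [Fintype J] [AddCommGroup V]

/-- The action of an integer matrix on vectors with entries in an abelian group. -/
def matAct (m : Matrix I J ℤ) : (J → V) →+ (I → V) where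
  toFun z i := ∑ j, m i j • z j
  map_zero' := by ext; simp
  map_add' z z' := by ext; simp [Finset.sum_add_distrib]

theorem matAct_apply (m : Matrix I J ℤ) (z : J → V) (i : I) :
    matAct m z i = ∑ j, m i j • z j := rfl

theorem matAct_mul [Fintype K] (m : Matrix I J ℤ) (m' : Matrix J K ℤ) (z : K → V) :
    matAct (m * m') z = matAct m (matAct m' z) := by
  ext i
  simp only [matAct_apply, Matrix.mul_apply, Finset.sum_smul, Finset.smul_sum, mul_smul]
  exact Finset.sum_comm

@[simp]
theorem matAct_one [Fintype I] [DecidableEq I] (z : I → V) : matAct (1 : Matrix I I ℤ) z = z := by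
  ext i
  simp [matAct_apply, Matrix.one_apply, ite_smul]

@[simp]
theorem matAct_neg_one [Fintype I] [DecidableEq I] (z : I → V) : matAct (-1 : Matrix I I ℤ) z = -z := by
  ext i
  simp [matAct_apply, Matrix.one_apply, ite_smul]

theorem matAct_smul {R : Type*} [Monoid R] [DistribMulAction R V]
    (m : Matrix I J ℤ) (c : R) (z : J → V) : matAct m (c • z) = c • matAct m z := by
  ext i
  simp only [matAct_apply, Pi.smul_apply, Finset.smul_sum]
  exact Finset.sum_congr rfl fun j _ ↦ (smul_comm c (m i j) (z j)).symm

theorem matAct_mem (L : Submodule ℤ V) (m : Matrix I J ℤ) {z : J → V} (hz : ∀ j, z j ∈ L) (i : I) :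
    matAct m z i ∈ L :=
  L.sum_mem fun j _ ↦ L.smul_mem _ (hz j)

/-- The action of a matrix on vectors over a complex vector space. -/
def matActL (m : Matrix I J ℤ) : (J → C2) →ₗ[ℂ] (I → C2) where
  toFun := matAct m
  map_add' := map_add _
  map_smul' c z := matAct_smul m c z

theorem differentiable_matAct [Fintype I] (m : Matrix I J ℤ) :
    Differentiable ℂ (matAct m : (J → C2) → (I → C2)) :=
  (LinearMap.toContinuousLinearMap (matActL m)).differentiable

/-- A real vector space has no torsion, so a nonzero `v` in each coordinate reads off the integer
entries. -/
theorem matAct_ext {m m' : Matrix I J ℤ} [DecidableEq J] [Module ℝ V] {v : V} (hv : v ≠ 0)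
    (h : ∀ j, matAct m (Pi.single j v) = matAct m' (Pi.single j v)) : m = m' := by
  ext i j
  have := congrFun (h j) i
  simp only [matAct_apply, Pi.single_apply, smul_ite, smul_zero, Finset.sum_ite_eq',
    Finset.mem_univ, if_true] at this
  have h2 : ((m i j : ℝ) - m' i j) • v = 0 := by
    rw [sub_smul, Int.cast_smul_eq_zsmul, Int.cast_smul_eq_zsmul, this, sub_self]
  have := (smul_eq_zero.1 h2).resolve_right hv
  exact_mod_cast sub_eq_zero.1 this

end MatAct

/-! ### The Weyl group in the basis of simple coroots -/

section WeylMatrix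

variable {ι M N : Type*} [AddCommGroup M] [Module ℝ M] [AddCommGroup N] [Module ℝ N]
  {P : RootPairing ι ℝ M N} (b : P.Base)

/-- The basis of simple coroots of the coroot lattice. -/
def corootBasis : Module.Basis b.support ℤ (CorootLattice P) :=
  b.flip.toWeightBasisInt

theorem corootBasis_apply (i : b.support) : corootBasis b i = P.corootSpanMem ℤ i :=
  Subtype.ext (b.flip.coe_toWeightBasisInt_apply i)

open Classical in
/-- The matrices of the Weyl group in the basis of simple coroots. -/
def weylMatrix : P.weylGroup →* Matrix b.support b.support ℤ :=
  (LinearMap.toMatrixAlgEquiv (corootBasis b)).toAlgHom.toMonoidHom.comp (weylCorootRep P)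

theorem weylCorootRep_corootBasis (w : P.weylGroup) (j : b.support) :
    weylCorootRep P w (corootBasis b j) = ∑ i, weylMatrix b w i j • corootBasis b i := by
  classical
  have := (corootBasis b).sum_repr (weylCorootRep P w (corootBasis b j))
  rw [← this]
  refine Finset.sum_congr rfl fun i _ ↦ ?_
  congr 1
  change _ = LinearMap.toMatrixAlgEquiv (corootBasis b) (weylCorootRep P w) i j
  rw [LinearMap.toMatrixAlgEquiv_apply]

/-- The inverse appears because passing to the coweight map reverses products. -/
theorem coweightMap_inv_coroot (w : P.weylGroup) (j : b.support) :
    (w⁻¹ : P.weylGroup).1.coweightMap (P.coroot j) =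
      ∑ i, weylMatrix b w i j • P.coroot (i : ι) := by
  have := congrArg Subtype.val (weylCorootRep_corootBasis b w j)
  simpa [corootBasis_apply, weylCorootRep] using this

/-- The reflection in the simple root `k` as a matrix. -/
def simpleReflectionMatrix {J : Type*} [DecidableEq J] (A : Matrix J J ℤ) (k : J) :
    Matrix J J ℤ :=
  Matrix.of fun i j ↦ (1 : Matrix J J ℤ) i j - if i = k then A k j else 0

theorem matAct_simpleReflectionMatrix {J V : Type*} [Fintype J] [DecidableEq J] [AddCommGroup V]
    (A : Matrix J J ℤ) (k : J) (z : J → V) :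
    matAct (simpleReflectionMatrix A k) z = z - Pi.single k (matAct A z k) := by
  ext i
  simp only [matAct_apply, simpleReflectionMatrix, Matrix.of_apply, sub_smul,
    Finset.sum_sub_distrib, Pi.sub_apply, Pi.single_apply]
  congr 1
  · simp [Matrix.one_apply, ite_smul]
  · split_ifs <;> simp

variable [P.IsCrystallographic]

open Classical in
theorem weylMatrix_ofIdx (k : b.support) :
    weylMatrix b (RootPairing.weylGroup.ofIdx P k) = simpleReflectionMatrix b.cartanMatrix k := by
  ext i j
  have h := weylCorootRep_corootBasis b (RootPairing.weylGroup.ofIdx P k) j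
  have h2 : weylCorootRep P (RootPairing.weylGroup.ofIdx P k) (corootBasis b j) =
      corootBasis b j - b.cartanMatrix k j • corootBasis b k := by
    ext
    have : ((RootPairing.weylGroup.ofIdx P k)⁻¹ : P.weylGroup).1 =
        RootPairing.Equiv.reflection P k := by
      change (RootPairing.Equiv.reflection P (k : ι))⁻¹ = _
      simp
    change ((RootPairing.weylGroup.ofIdx P k)⁻¹ : P.weylGroup).1.coweightMap _ = _
    rw [this]
    simp only [corootBasis_apply]
    change P.coreflection k (P.coroot j) = P.coroot j - b.cartanMatrix k j • P.coroot k
    rw [RootPairing.coreflection_apply_coroot, ← b.algebraMap_cartanMatrixIn_apply ℤ]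
    exact congrArg _ (Int.cast_smul_eq_zsmul ℝ _ _)
  have h3 := congrArg (fun x ↦ (corootBasis b).repr x i) (h.symm.trans h2)
  simp only [map_sum, map_zsmul, map_sub, Module.Basis.repr_self, Finsupp.coe_finsetSum,
    Finset.sum_apply, Finsupp.smul_apply, Finsupp.sub_apply, Finsupp.single_apply] at h3
  simp only [smul_eq_mul, mul_ite, mul_one, mul_zero, Finset.sum_ite_eq', Finset.mem_univ,
    if_true] at h3
  rw [h3]
  simp only [simpleReflectionMatrix, Matrix.of_apply, Matrix.one_apply, eq_comm]

omit [P.IsCrystallographic] in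
-- The simple coroots span `N` over `ℝ`, and an automorphism of a root pairing is determined by its
-- coweight map.
theorem weylMatrix_injective [P.IsRootSystem] : Function.Injective (weylMatrix b) := by
  intro w w' h
  rw [← inv_inj]
  apply Subtype.ext
  apply RootPairing.Equiv.coweightHom_injective P
  apply MulOpposite.unop_injective
  apply LinearEquiv.toLinearMap_injective
  refine b.toCoweightBasis.ext fun j ↦ ?_
  rw [RootPairing.Base.toCoweightBasis_apply]
  change (w⁻¹ : P.weylGroup).1.coweightMap (P.coroot j) =
    (w'⁻¹ : P.weylGroup).1.coweightMap (P.coroot j)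
  rw [coweightMap_inv_coroot b, coweightMap_inv_coroot b, h]

omit [P.IsCrystallographic] in
theorem finite_weylGroup [Finite ι] [P.IsRootSystem] : Finite P.weylGroup := by
  have : Function.Injective P.weylGroupToPerm := by
    intro w w' h
    apply Subtype.ext
    apply RootPairing.Equiv.weightHom_injective P
    apply LinearEquiv.toLinearMap_injective
    refine LinearMap.ext_on_range (v := P.root) RootPairing.IsRootSystem.span_root_eq_top fun i ↦ ?_
    change w • P.root i = w' • P.root i
    rw [RootPairing.weylGroup_apply_root, RootPairing.weylGroup_apply_root, h]
  exact Finite.of_injective _ this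

end WeylMatrix

/-! ### Coordinates on `B ⊗ Λ` -/

section TensorCoord

variable {ι M N : Type*} [AddCommGroup M] [Module ℝ M] [AddCommGroup N] [Module ℝ N]
  {P : RootPairing ι ℝ M N} {B : Type*} [AddCommGroup B] (q : C2 →ₗ[ℤ] B) (b : P.Base)

theorem smul_tensorCoord (w : P.weylGroup) (z : b.support → C2) :
    w • tensorCoord q b z = tensorCoord q b (matAct (weylMatrix b w) z) := by
  change (weylCorootRep P w).lTensor B (tensorCoord q b z) = _
  simp only [tensorCoord, map_sum, LinearMap.lTensor_tmul, ← corootBasis_apply,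
    weylCorootRep_corootBasis, matAct_apply, TensorProduct.tmul_sum, TensorProduct.sum_tmul,
    map_zsmul]
  rw [Finset.sum_comm]
  refine Finset.sum_congr rfl fun i _ ↦ Finset.sum_congr rfl fun j _ ↦ ?_
  rw [TensorProduct.smul_tmul]

theorem tensorCoord_eq_iff (z z' : b.support → C2) :
    tensorCoord q b z = tensorCoord q b z' ↔ ∀ i, q (z i) = q (z' i) := by
  classical
  constructor
  · intro h i
    have key : ∀ z : b.support → C2,
        TensorProduct.equivFinsuppOfBasisRight (corootBasis b) (tensorCoord q b z) i = q (z i) := by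
      intro z
      simp [tensorCoord, ← corootBasis_apply, Finsupp.single_apply]
    rw [← key, ← key, h]
  · intro h
    simp [tensorCoord, h]

theorem tensorCoord_surjective (hq : Function.Surjective q) :
    Function.Surjective (tensorCoord q b) := by
  classical
  intro t
  choose z hz using fun i ↦ hq (TensorProduct.equivFinsuppOfBasisRight (corootBasis b) t i)
  refine ⟨z, ?_⟩
  apply (TensorProduct.equivFinsuppOfBasisRight (M := B) (corootBasis b)).injective
  ext i
  rw [← hz i]
  simp [tensorCoord, ← corootBasis_apply, Finsupp.single_apply]

end TensorCoord

/-! ### The quotient map onto `(A ⊗ Λ) / W` -/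

section Torus

variable {ι M N : Type*} [AddCommGroup M] [Module ℝ M] [AddCommGroup N] [Module ℝ N]
  {P : RootPairing ι ℝ M N}

/-- The quotient map `(ℂ²)^l → (A ⊗ Λ) / W`. -/
def torusQuotientMap (L : Submodule ℤ C2) (b : P.Base) (z : b.support → C2) :
    MulAction.orbitRel.Quotient P.weylGroup ((C2 ⧸ L) ⊗[ℤ] CorootLattice P) :=
  Quotient.mk _ (tensorCoord L.mkQ b z)

theorem torusQuotient_eq (L : Submodule ℤ C2) (b : P.Base) :
    torusQuotient L b = (std (b.support → C2)).quotient (torusQuotientMap L b) := by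
  unfold torusQuotient AnalyticStructure.quotient
  simp only [AnalyticStructure.mk.injEq]
  exact ⟨coinduced_compose, rfl⟩

theorem smul_tensorCoord_mkQ_eq_iff (L : Submodule ℤ C2) (b : P.Base) (w : P.weylGroup)
    (z z' : b.support → C2) :
    w • tensorCoord L.mkQ b z = tensorCoord L.mkQ b z' ↔
      ∀ i, (matAct (weylMatrix b w) z - z') i ∈ L := by
  rw [smul_tensorCoord, tensorCoord_eq_iff]
  simp [Submodule.Quotient.eq]

theorem torusQuotientMap_eq_iff (L : Submodule ℤ C2) (b : P.Base) (z z' : b.support → C2) :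
    torusQuotientMap L b z = torusQuotientMap L b z' ↔
      ∃ w : P.weylGroup, ∀ i, (matAct (weylMatrix b w) z - z') i ∈ L := by
  rw [eq_comm]
  refine Quotient.eq.trans ?_
  simp only [← smul_tensorCoord_mkQ_eq_iff]
  rfl

theorem weylMatrix_inv_matAct {V : Type*} [AddCommGroup V] (b : P.Base) (w : P.weylGroup)
    (z : b.support → V) : matAct (weylMatrix b w⁻¹) (matAct (weylMatrix b w) z) = z := by
  classical
  rw [← matAct_mul, ← map_mul, inv_mul_cancel, map_one, matAct_one]

theorem weylMatrix_matAct_inv {V : Type*} [AddCommGroup V] (b : P.Base) (w : P.weylGroup)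
    (z : b.support → V) : matAct (weylMatrix b w) (matAct (weylMatrix b w⁻¹) z) = z := by
  simpa using weylMatrix_inv_matAct b w⁻¹ z

/-- The action of an element of the Weyl group as a homeomorphism. -/
def weylHomeomorph (b : P.Base) (w : P.weylGroup) : (b.support → C2) ≃ₜ (b.support → C2) where
  toFun := matAct (weylMatrix b w)
  invFun := matAct (weylMatrix b w⁻¹)
  left_inv := weylMatrix_inv_matAct b w
  right_inv := weylMatrix_matAct_inv b w
  continuous_toFun := (differentiable_matAct _).continuous
  continuous_invFun := (differentiable_matAct _).continuous

/-- The fibres are orbits of affine maps: a Weyl element followed by a translation in `L^n`. -/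
theorem isHolQuotientMap_torusQuotientMap (L : Submodule ℤ C2) (b : P.Base) :
    IsHolQuotientMap (torusQuotientMap L b) where
  surjective := Quotient.mk_surjective.comp (tensorCoord_surjective _ b L.mkQ_surjective)
  exists_homeomorph z z' h := by
    obtain ⟨w, hw⟩ := (torusQuotientMap_eq_iff L b z z').1 h
    refine ⟨(weylHomeomorph b w).trans
      (Homeomorph.subRight (matAct (weylMatrix b w) z - z')), ?_, ?_, fun u ↦ ?_⟩
    · exact (differentiable_matAct _).sub_const _
    · simp [weylHomeomorph]
    · rw [eq_comm, torusQuotientMap_eq_iff]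
      exact ⟨w, by simpa [weylHomeomorph] using hw⟩

theorem linearQuotientMap_eq_iff (b : P.Base) (H : Subgroup P.weylGroup) (z z' : b.support → C2) :
    linearQuotientMap b H z = linearQuotientMap b H z' ↔
      ∃ w ∈ H, matAct (weylMatrix b w) z = z' := by
  rw [eq_comm]
  refine Quotient.eq.trans ?_
  have : ∀ w : P.weylGroup, matAct (weylMatrix b w) z = z' ↔
      w • tensorCoord LinearMap.id b z = tensorCoord LinearMap.id b z' := by
    intro w
    rw [smul_tensorCoord, tensorCoord_eq_iff, funext_iff]
    rfl
  simp only [this]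
  exact ⟨fun ⟨w, hw⟩ ↦ ⟨w.1, w.2, hw⟩, fun ⟨w, hwH, hw⟩ ↦ ⟨⟨w, hwH⟩, hw⟩⟩

theorem isHolQuotientMap_linearQuotientMap (b : P.Base) (H : Subgroup P.weylGroup) :
    IsHolQuotientMap (linearQuotientMap b H) where
  surjective := Quotient.mk_surjective.comp
    (tensorCoord_surjective _ b Function.surjective_id)
  exists_homeomorph z z' h := by
    obtain ⟨w, hwH, hw⟩ := (linearQuotientMap_eq_iff b H z z').1 h
    refine ⟨weylHomeomorph b w, differentiable_matAct _, hw, fun u ↦ ?_⟩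
    rw [eq_comm, linearQuotientMap_eq_iff]
    exact ⟨w, hwH, rfl⟩

end Torus

theorem signQuotientMap_eq_iff {l : ℕ} (z z' : Fin l → C2) :
    signQuotientMap l z = signQuotientMap l z' ↔ z = z' ∨ -z = z' := by
  rw [eq_comm]
  refine Quotient.eq.trans ?_
  constructor
  · rintro ⟨u, hu⟩
    rcases Int.units_eq_one_or u with rfl | rfl
    · left; simpa using hu
    · right; simpa using hu
  · rintro (h | h)
    · exact ⟨1, by simpa using h⟩
    · exact ⟨-1, by simpa using h⟩

theorem isHolQuotientMap_signQuotientMap (l : ℕ) : IsHolQuotientMap (signQuotientMap l) where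
  surjective := Quotient.mk_surjective
  exists_homeomorph z z' h := by
    rcases (signQuotientMap_eq_iff z z').1 h with h | h
    · exact ⟨Homeomorph.refl _, differentiable_id, h, fun _ ↦ rfl⟩
    · refine ⟨Homeomorph.neg _, differentiable_id.neg, h, fun u ↦ ?_⟩
      rw [eq_comm, signQuotientMap_eq_iff]
      exact Or.inr rfl

/-! ### The local structure of `(A ⊗ Λ) / W` -/

/-- The coset `c + L` is closed and discrete, so 0 is at positive distance from its other elements.
-/
theorem exists_pos_forall_add_norm_lt (L : Submodule ℤ C2) [DiscreteTopology L] (c : C2) :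
    ∃ ε > 0, ∀ x ∈ L, ‖c + x‖ < ε → c + x = 0 := by
  have hcl : IsClosed ((L : Set C2) \ {-c}) := by
    have h1 : IsClosed (L : Set C2) := by
      have : DiscreteTopology L.toAddSubgroup := ‹DiscreteTopology L›
      exact AddSubgroup.isClosed_of_discrete (H := L.toAddSubgroup)
    have h2 : DiscreteTopology (L : Set C2) := ‹DiscreteTopology L›
    have h3 : IsClosed (Subtype.val '' ({y : (L : Set C2) | (y : C2) ≠ -c})) :=
      h1.isClosedEmbedding_subtypeVal.isClosedMap _ (isClosed_discrete _)
    convert h3 using 1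
    ext y
    simp [and_comm]
  have hmem : ((L : Set C2) \ {-c})ᶜ ∈ 𝓝 (-c) := hcl.isOpen_compl.mem_nhds (by simp)
  obtain ⟨ε, hε, hball⟩ := Metric.mem_nhds_iff.1 hmem
  refine ⟨ε, hε, fun x hx hlt ↦ ?_⟩
  by_contra hne
  refine hball (show x ∈ Metric.ball (-c) ε from ?_) ⟨hx, ?_⟩
  · rwa [mem_ball_iff_norm, sub_neg_eq_add, add_comm]
  · intro h
    apply hne
    rw [Set.mem_singleton_iff.1 h]
    simp

theorem exists_pos_forall_pi_norm_lt {I : Type*} [Fintype I] (L : Submodule ℤ C2)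
    [DiscreteTopology L] (c : I → C2) :
    ∃ ε > 0, ∀ x : I → C2, (∀ i, (x - c) i ∈ L) → ‖x‖ < ε → x = 0 := by
  choose ε hε h using fun i ↦ exists_pos_forall_add_norm_lt L (c i)
  obtain ⟨δ, hδ, hδε⟩ : ∃ δ > 0, ∀ i, δ ≤ ε i := by
    rcases isEmpty_or_nonempty I with hI | hI
    · exact ⟨1, one_pos, fun i ↦ (hI.false i).elim⟩
    · obtain ⟨i, hi⟩ := Finite.exists_min ε
      exact ⟨ε i, hε i, hi⟩
  refine ⟨δ, hδ, fun x hx hlt ↦ funext fun i ↦ ?_⟩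
  have h1 := h i ((x - c) i) (hx i)
  simp only [Pi.sub_apply, add_sub_cancel] at h1
  exact h1 (((norm_le_pi_norm x i).trans_lt hlt).trans_le (hδε i))

section LocalModel

variable {ι M N : Type*} [Finite ι] [AddCommGroup M] [Module ℝ M] [AddCommGroup N] [Module ℝ N]
  {P : RootPairing ι ℝ M N} [P.IsRootSystem]

/-- Near the image of a point, `(A ⊗ Λ) / W` is the quotient of `ℂ² ⊗ Λ` by the stabilizer of the
point. -/
theorem torusQuotient_locallyModeledOn (L : Submodule ℤ C2) [DiscreteTopology L] (b : P.Base)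
    (z : b.support → C2) {E Y : Type*} [NormedAddCommGroup E] [NormedSpace ℂ E] {ρ : E → Y}
    (hρ : IsHolQuotientMap ρ) (B : E ≃L[ℂ] (b.support → C2))
    (hB : ∀ u v, ρ u = ρ v ↔ ∃ w : P.weylGroup,
      w • tensorCoord L.mkQ b z = tensorCoord L.mkQ b z ∧ matAct (weylMatrix b w) (B u) = B v) :
    (torusQuotient L b).LocallyModeledOn (Quotient.mk _ (tensorCoord L.mkQ b z))
      ((std E).quotient ρ) (ρ 0) := by
  have := finite_weylGroup (P := P)
  choose ε hε h using fun w : P.weylGroup ↦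
    exists_pos_forall_pi_norm_lt L (z - matAct (weylMatrix b w) z)
  obtain ⟨δ, hδ⟩ := Finite.exists_min ε
  have hδ0 := hε δ
  set d := ε δ
  -- Bounding the whole `W`-orbit makes `U` saturated. The radius is halved because a difference of
  -- two such vectors must have norm below `d`.
  let U : Set E := {u | ∀ w : P.weylGroup, ‖matAct (weylMatrix b w) (B u)‖ < d / 2}
  have hU : IsOpen U := by
    have : U = ⋂ w : P.weylGroup, {u | ‖matAct (weylMatrix b w) (B u)‖ < d / 2} := by
      ext; simp [U]
    rw [this]
    refine isOpen_iInter_of_finite fun w ↦ isOpen_lt ?_ continuous_const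
    exact ((differentiable_matAct _).continuous.comp B.continuous).norm
  rw [torusQuotient_eq]
  have hz : torusQuotientMap L b z = torusQuotientMap L b
      ((B.toHomeomorph.trans (Homeomorph.addLeft z)) 0) := by simp
  change ((std _).quotient _).LocallyModeledOn (torusQuotientMap L b z) _ _
  rw [hz]
  refine locallyModeledOn_of_biholomorphism (U := U) (isHolQuotientMap_torusQuotientMap L b) hρ
    (B.toHomeomorph.trans (Homeomorph.addLeft z)) ?_ ?_ hU ?_ ?_ ?_
  · exact B.differentiable.const_add z
  · exact B.symm.differentiable.comp (differentiable_id.const_add (-z))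
  · intro w
    simpa using half_pos hδ0
  · intro u hu v huv w
    obtain ⟨w', -, hw'⟩ := (hB u v).1 huv
    rw [← hw', ← matAct_mul, ← map_mul]
    exact hu _
  · intro u hu v hv
    simp only [Homeomorph.trans_apply, ContinuousLinearEquiv.coe_toHomeomorph,
      Homeomorph.coe_addLeft]
    rw [hB, torusQuotientMap_eq_iff]
    refine exists_congr fun w ↦ ?_
    rw [smul_tensorCoord_mkQ_eq_iff]
    have key : matAct (weylMatrix b w) (z + B u) - (z + B v) =
        (matAct (weylMatrix b w) (B u) - B v) - (z - matAct (weylMatrix b w) z) := by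
      rw [map_add]; abel
    rw [key]
    constructor
    -- The difference `w (B u) - B v` lies in a fixed coset of `L^n` and is shorter than `d`, hence
    -- vanishes; then `w` also fixes `z` modulo `L^n`.
    · intro hL
      have h0 := h w _ hL (lt_of_lt_of_le ?_ (hδ w))
      · rw [h0] at hL
        refine ⟨by simpa using hL, sub_eq_zero.1 h0⟩
      · have h1 := hu w
        have h2 : ‖B v‖ < d / 2 := by
          classical
          have := hv 1
          rwa [map_one, matAct_one] at this
        calc _ ≤ _ := norm_sub_le _ _
          _ < d / 2 + d / 2 := add_lt_add h1 h2
          _ = d := add_halves d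
    · rintro ⟨hL, heq⟩
      rw [heq, sub_self, zero_sub]
      simpa using hL

end LocalModel

/-! ### Simple reflections and stabilizers -/

theorem exists_list_prod_of_mem_closure {G J : Type*} [Group G] {f : J → G}
    (hf : ∀ j, (f j)⁻¹ = f j) {w : G} (hw : w ∈ Subgroup.closure (Set.range f)) :
    ∃ l : List J, (l.map f).prod = w := by
  induction hw using Subgroup.closure_induction with
  | mem x hx => obtain ⟨i, rfl⟩ := hx; exact ⟨[i], by simp⟩
  | one => exact ⟨[], rfl⟩
  | mul x y _ _ ihx ihy =>
    obtain ⟨l, rfl⟩ := ihx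
    obtain ⟨l', rfl⟩ := ihy
    exact ⟨l ++ l', by simp⟩
  | inv x _ ih =>
    obtain ⟨l, rfl⟩ := ih
    refine ⟨l.reverse, ?_⟩
    rw [List.prod_inv_reverse, List.map_map, List.map_reverse]
    congr 3
    exact funext fun i ↦ (hf i).symm

section Exchange

open RootPairing

variable {ι M N : Type*} [AddCommGroup M] [Module ℝ M] [AddCommGroup N] [Module ℝ N]
  {P : RootPairing ι ℝ M N}

theorem weylGroup_ofIdx_mul_self (i : ι) : weylGroup.ofIdx P i * weylGroup.ofIdx P i = 1 := by
  apply Subtype.ext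
  change Equiv.reflection P i * Equiv.reflection P i = 1
  rw [mul_eq_one_iff_inv_eq, Equiv.reflection_inv P i]

theorem weylGroup_ofIdx_inv (i : ι) : (weylGroup.ofIdx P i)⁻¹ = weylGroup.ofIdx P i :=
  inv_eq_of_mul_eq_one_left (weylGroup_ofIdx_mul_self i)

theorem weylGroupToPerm_ofIdx (i : ι) :
    P.weylGroupToPerm (weylGroup.ofIdx P i) = P.reflectionPerm i :=
  Equiv.reflection_indexEquiv P i

theorem weylGroup_ofIdx_reflectionPerm (i k : ι) :
    weylGroup.ofIdx P (P.reflectionPerm i k) =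
      weylGroup.ofIdx P i * weylGroup.ofIdx P k * weylGroup.ofIdx P i := by
  apply Subtype.ext
  apply Equiv.weightHom_injective P
  rw [Subgroup.coe_mul, Subgroup.coe_mul, map_mul, map_mul]
  change Equiv.weightEquiv P P (Equiv.reflection P _) = Equiv.weightEquiv P P (Equiv.reflection P _)
    * Equiv.weightEquiv P P (Equiv.reflection P _) * Equiv.weightEquiv P P (Equiv.reflection P _)
  simp only [Equiv.reflection_weightEquiv, reflection_reflectionPerm]

theorem weylGroup_mul_ofIdx_mul_inv (w : P.weylGroup) (k : ι) :
    w * weylGroup.ofIdx P k * w⁻¹ = weylGroup.ofIdx P (P.weylGroupToPerm w k) := by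
  obtain ⟨w, hw⟩ := w
  induction hw using weylGroup.induction generalizing k with
  | mem i =>
    change weylGroup.ofIdx P i * weylGroup.ofIdx P k * (weylGroup.ofIdx P i)⁻¹ =
      weylGroup.ofIdx P (P.weylGroupToPerm (weylGroup.ofIdx P i) k)
    rw [weylGroupToPerm_ofIdx, weylGroup_ofIdx_reflectionPerm, weylGroup_ofIdx_inv]
  | one =>
    change (1 : P.weylGroup) * _ * (1 : P.weylGroup)⁻¹ =
      weylGroup.ofIdx P (P.weylGroupToPerm (1 : P.weylGroup) k)
    simp
  | mul x y hx hy ihx ihy =>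
    have h1 : (⟨x * y, mul_mem hx hy⟩ : P.weylGroup) = ⟨x, hx⟩ * ⟨y, hy⟩ := rfl
    rw [h1, map_mul, Equiv.Perm.mul_apply, ← ihx, ← ihy]
    group

variable [Finite ι] [P.IsCrystallographic] [P.IsReduced] (b : P.Base)

/-- Every root arises from a simple one by simple reflections, and moving a root by `s` conjugates
its reflection by `s`. -/
theorem closure_simpleReflections :
    Subgroup.closure (Set.range fun i : b.support ↦ weylGroup.ofIdx P (i : ι)) = ⊤ := by
  have key : ∀ i, weylGroup.ofIdx P i ∈
      Subgroup.closure (Set.range fun i : b.support ↦ weylGroup.ofIdx P (i : ι)) := by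
    intro i
    refine b.induction_reflect i (p := fun i ↦ weylGroup.ofIdx P i ∈
      Subgroup.closure (Set.range fun i : b.support ↦ weylGroup.ofIdx P (i : ι))) ?_ ?_ ?_
    · intro i hi
      rw [weylGroup_ofIdx_reflectionPerm, weylGroup_ofIdx_mul_self, one_mul]
      exact hi
    · exact fun i hi ↦ Subgroup.subset_closure ⟨⟨i, hi⟩, rfl⟩
    · intro i j hi hj
      have hj' : weylGroup.ofIdx P j ∈ Subgroup.closure
          (Set.range fun i : b.support ↦ weylGroup.ofIdx P (i : ι)) :=
        Subgroup.subset_closure ⟨⟨j, hj⟩, rfl⟩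
      rw [weylGroup_ofIdx_reflectionPerm]
      exact mul_mem (mul_mem hj' hi) hj'
  rw [eq_top_iff]
  rintro ⟨w, hw⟩ -
  induction hw using weylGroup.induction with
  | mem i => exact key i
  | one => exact one_mem _
  | mul x y hx hy ihx ihy => exact mul_mem ihx ihy

/-- The product of a word in the simple reflections. -/
def simpleWord (l : List b.support) : P.weylGroup :=
  (l.map fun i : b.support ↦ weylGroup.ofIdx P (i : ι)).prod

theorem exists_simpleWord (w : P.weylGroup) : ∃ l, simpleWord b l = w := by
  refine exists_list_prod_of_mem_closure (fun i ↦ weylGroup_ofIdx_inv _) ?_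
  rw [closure_simpleReflections]
  trivial

/-- The exchange property. -/
theorem exists_simpleWord_eq_mul_ofIdx (k : b.support) (l : List b.support)
    (h : ¬ b.IsPos (P.weylGroupToPerm (simpleWord b l) k)) :
    ∃ l' : List b.support, l'.length + 1 = l.length ∧
      simpleWord b l * weylGroup.ofIdx P k = simpleWord b l' := by
  induction l with
  | nil =>
    refine absurd (Base.isPos_of_mem_support k.2) ?_
    simpa [simpleWord] using h
  | cons a l ih =>
    have hcons : simpleWord b (a :: l) = weylGroup.ofIdx P (a : ι) * simpleWord b l := rfl
    by_cases hl : b.IsPos (P.weylGroupToPerm (simpleWord b l) k)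
    -- A simple reflection permutes the positive roots other than its own, so the only root that `a`
    -- can turn from positive to negative is `a` itself.
    · have hβ : P.weylGroupToPerm (simpleWord b l) k = a := by
        by_contra hne
        apply h
        rw [hcons, map_mul, Equiv.Perm.mul_apply, weylGroupToPerm_ofIdx]
        exact hl.reflectionPerm a.2 hne
      refine ⟨l, rfl, ?_⟩
      rw [hcons, ← hβ, ← weylGroup_mul_ofIdx_mul_inv]
      simp [mul_assoc, weylGroup_ofIdx_mul_self]
    · obtain ⟨l', hl', h'⟩ := ih hl
      refine ⟨a :: l', by simp [hl'], ?_⟩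
      rw [hcons, mul_assoc, h']
      rfl

omit [Finite ι] [P.IsCrystallographic] [P.IsReduced] in
theorem nonneg_apply_root_of_isPos (t : M →ₗ[ℝ] ℝ) (ht : ∀ i ∈ b.support, 0 ≤ t (P.root i))
    {i : ι} (hi : b.IsPos i) : 0 ≤ t (P.root i) := by
  obtain ⟨f, -, hf, hsum⟩ := b.exists_root_eq_sum_int i
  have hf0 : 0 < f := by
    refine hf.resolve_right fun hneg ↦ ?_
    have := (b.isPos_iff).1 hi
    rw [Base.height_eq_sum hsum] at this
    exact absurd this (not_lt.2 (Finset.sum_nonpos fun j _ ↦ hneg.le j))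
  rw [hsum, map_sum]
  refine Finset.sum_nonneg fun j hj ↦ ?_
  rw [map_zsmul]
  exact zsmul_nonneg (ht j hj) (hf0.le j)

/-- The stabilizer of a dominant functional is generated by the simple reflections that fix it. -/
theorem mem_closure_of_fixes_dominant (t : M →ₗ[ℝ] ℝ)
    (ht : ∀ i ∈ b.support, 0 ≤ t (P.root i)) (w : P.weylGroup) (hw : ∀ x, t (w • x) = t x) :
    w ∈ Subgroup.closure
      ((fun i : b.support ↦ weylGroup.ofIdx P (i : ι)) '' {i | t (P.root i) = 0}) := by
  obtain ⟨l, rfl⟩ := exists_simpleWord b w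
  induction hn : l.length using Nat.strong_induction_on generalizing l with
  | _ n ih =>
    rcases List.eq_nil_or_concat l with rfl | ⟨l, k, rfl⟩
    · exact one_mem _
    have hlen : l.length + 1 = n := by simpa using hn
    have hcat : simpleWord b (l ++ [k]) = simpleWord b l * weylGroup.ofIdx P (k : ι) := by
      simp [simpleWord]
    simp only [List.concat_eq_append] at hw ⊢
    by_cases hpos : b.IsPos (P.weylGroupToPerm (simpleWord b l) k)
    -- Here `w` sends the simple root `k` to a negative root, on which `t` is nonpositive;
    -- invariance of `t` then gives `t (root k) ≤ 0`.
    · have hk0 : t (P.root k) = 0 := by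
        refine le_antisymm ?_ (ht k k.2)
        have h1 := nonneg_apply_root_of_isPos b t ht hpos
        have h2 : P.root (P.weylGroupToPerm (simpleWord b l) k) =
            -(simpleWord b (l ++ [k]) • P.root k) := by
          rw [← weylGroup_apply_root, hcat, mul_smul, weylGroup.ofIdx_smul, Equiv.reflection_smul]
          simp
        rw [h2, map_neg, hw] at h1
        linarith
      have hsk : ∀ x, t (weylGroup.ofIdx P (k : ι) • x) = t x := by
        intro x
        rw [weylGroup.ofIdx_smul, Equiv.reflection_smul, reflection_apply]
        simp [hk0]
      have hl : ∀ x, t (simpleWord b l • x) = t x := by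
        intro x
        have := hw (weylGroup.ofIdx P (k : ι) • x)
        rwa [hcat, smul_smul, mul_assoc, weylGroup_ofIdx_mul_self, mul_one, hsk] at this
      rw [hcat]
      exact mul_mem (ih l.length (by omega) l hl rfl) (Subgroup.subset_closure ⟨k, hk0, rfl⟩)
    -- Otherwise the word is not reduced, and exchange gives a word for the same element with two
    -- letters fewer.
    · obtain ⟨l', hl', h'⟩ := exists_simpleWord_eq_mul_ofIdx b k l hpos
      rw [hcat, h'] at hw ⊢
      exact ih l'.length (by omega) l' hw rfl

end Exchange

/-! ### Parabolic subgroups -/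

section Embed

variable {I J V : Type*} [Fintype J] [AddCommGroup V]

open Classical in
/-- The matrix of the inclusion of coordinates `e`. -/
def embedMatrix (e : J ↪ I) : Matrix I J ℤ := Matrix.of fun i j ↦ if i = e j then 1 else 0

theorem matAct_embedMatrix_apply (e : J ↪ I) (u : J → V) (j : J) :
    matAct (embedMatrix e) u (e j) = u j := by
  rw [matAct_apply, Finset.sum_eq_single j]
  · simp [embedMatrix]
  · intro k _ hk
    simp [embedMatrix, hk.symm]
  · simp

theorem matAct_embedMatrix_injective (e : J ↪ I) :
    Function.Injective (matAct (embedMatrix e) : (J → V) → (I → V)) := by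
  intro u u' h
  ext j
  rw [← matAct_embedMatrix_apply e u, h, matAct_embedMatrix_apply]

/-- The reflection changes only the coordinate `e k`, so it preserves the vectors supported on the
image of `e`. -/
theorem simpleReflectionMatrix_mul_embedMatrix [Fintype I] [DecidableEq I] [DecidableEq J]
    (A : Matrix I I ℤ) (e : J ↪ I) (k : J) :
    simpleReflectionMatrix A (e k) * embedMatrix e =
      embedMatrix e * simpleReflectionMatrix (A.submatrix e e) k := by
  ext i j
  rw [Matrix.mul_apply, Matrix.mul_apply]
  simp only [embedMatrix, Matrix.of_apply, mul_ite, mul_one, mul_zero, Finset.sum_ite_eq',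
    Finset.mem_univ, if_true, simpleReflectionMatrix, ite_mul, one_mul, zero_mul,
    Matrix.submatrix_apply, Matrix.one_apply]
  by_cases hi : ∃ l, e l = i
  · obtain ⟨l, rfl⟩ := hi
    simp
  · have h : ∀ l, i ≠ e l := fun l hl ↦ hi ⟨l, hl.symm⟩
    simp [h]

end Embed

/-- Multiplying by the adjugate gives `det m • u = 0` while staying with integer matrices. -/
theorem eq_zero_of_matAct_eq_zero {J V : Type*} [Fintype J] [DecidableEq J] [AddCommGroup V]
    [Module ℝ V] {m : Matrix J J ℤ} (hm : m.det ≠ 0) {u : J → V} (h : matAct m u = 0) : u = 0 := by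
  have h1 : matAct (m.adjugate * m) u = 0 := by rw [matAct_mul, h, map_zero]
  rw [Matrix.adjugate_mul] at h1
  ext j
  have h2 := congrFun h1 j
  simp only [matAct_apply, Matrix.smul_apply, Matrix.one_apply, smul_eq_mul, mul_ite, mul_one,
    mul_zero, ite_smul, zero_smul, Finset.sum_ite_eq, Finset.mem_univ, if_true,
    Pi.zero_apply] at h2
  rw [← Int.cast_smul_eq_zsmul ℝ] at h2
  exact (smul_eq_zero.1 h2).resolve_left (by exact_mod_cast hm)

section Levi

open RootPairing

variable {ι M N : Type*} [AddCommGroup M] [Module ℝ M] [AddCommGroup N] [Module ℝ N]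
  {P : RootPairing ι ℝ M N} (b : P.Base) {J : Type*} (e : J ↪ b.support)

/-- The parabolic subgroup generated by the simple reflections in the image of `e`. -/
def parabolicSubgroup : Subgroup P.weylGroup :=
  Subgroup.closure (Set.range fun j ↦ weylGroup.ofIdx P (e j : ι))

variable {b e} in
theorem exists_list_of_mem_parabolicSubgroup {w : P.weylGroup} (hw : w ∈ parabolicSubgroup b e) :
    ∃ l : List J, (l.map fun j ↦ weylGroup.ofIdx P (e j : ι)).prod = w :=
  exists_list_prod_of_mem_closure (fun _ ↦ weylGroup_ofIdx_inv _) hw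

variable {e} in
theorem ofIdx_mem_parabolicSubgroup (j : J) :
    weylGroup.ofIdx P (e j : ι) ∈ parabolicSubgroup b e :=
  Subgroup.subset_closure ⟨j, rfl⟩

variable [Fintype J] [P.IsCrystallographic]

/-- The span of the simple coroots of the subdiagram is stable under the parabolic subgroup, which
acts on it through the reflections of the smaller Cartan matrix. -/
theorem weylMatrix_list_prod_mul_embedMatrix [DecidableEq J] (l : List J) :
    weylMatrix b (l.map fun j ↦ weylGroup.ofIdx P (e j : ι)).prod * embedMatrix e =
      embedMatrix e * (l.map (simpleReflectionMatrix (b.cartanMatrix.submatrix e e))).prod := by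
  classical
  induction l with
  | nil => simp
  | cons k l ih =>
    rw [List.map_cons, List.map_cons, List.prod_cons, List.prod_cons, map_mul, Matrix.mul_assoc, ih,
      ← Matrix.mul_assoc, weylMatrix_ofIdx, simpleReflectionMatrix_mul_embedMatrix,
      Matrix.mul_assoc]

omit [Fintype J] in
variable {b e} in
-- A vector on which the simple roots `e k` vanish is fixed by each generator.
theorem matAct_eq_self_of_mem_parabolicSubgroup {V : Type*} [AddCommGroup V] {z : b.support → V}
    (hz : ∀ k, matAct b.cartanMatrix z (e k) = 0) {w : P.weylGroup}
    (hw : w ∈ parabolicSubgroup b e) : matAct (weylMatrix b w) z = z := by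
  classical
  obtain ⟨l, rfl⟩ := exists_list_of_mem_parabolicSubgroup hw
  induction l with
  | nil => simp
  | cons k l ih =>
    rw [List.map_cons, List.prod_cons, map_mul, matAct_mul,
      ih (Subgroup.list_prod_mem _ fun x hx ↦ ?_), weylMatrix_ofIdx, matAct_simpleReflectionMatrix,
      hz]
    · simp
    · obtain ⟨j, -, rfl⟩ := List.mem_map.1 hx
      exact ofIdx_mem_parabolicSubgroup b j

variable [Finite ι] [P.IsRootSystem]

/-- A positive diagonal rescaling of the Cartan matrix is positive definite, and this passes to
principal submatrices. -/
theorem det_cartanMatrix_submatrix_ne_zero [DecidableEq J] :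
    (b.cartanMatrix.submatrix e e).det ≠ 0 := by
  classical
  obtain ⟨d, hd, hpos⟩ := b.exists_cartanMatrix_diagaonal_mul_posDef
  intro h0
  obtain ⟨v, hv, hv0⟩ := Matrix.exists_mulVec_eq_zero_iff.2 h0
  have hsub := hpos.submatrix e.injective
  have := hsub.dotProduct_mulVec_pos hv
  have hmul : (Matrix.diagonal d * b.cartanMatrix).submatrix e e =
      Matrix.diagonal (d ∘ e) * b.cartanMatrix.submatrix e e := by
    ext i j
    simp [Matrix.diagonal_mul]
  rw [hmul, ← Matrix.mulVec_mulVec, hv0] at this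
  simp at this

/-- The coordinates of the fundamental coweights. -/
def fundamentalCoweights [DecidableEq b.support] : Matrix b.support b.support ℝ :=
  (b.cartanMatrix.map (Int.cast : ℤ → ℝ))⁻¹

theorem cartanMatrix_mul_fundamentalCoweights [DecidableEq b.support] :
    b.cartanMatrix.map (Int.cast : ℤ → ℝ) * fundamentalCoweights b = 1 := by
  apply Matrix.mul_nonsing_inv
  have h := b.cartanMatrix_nondegenerate
  rw [Matrix.nondegenerate_iff_det_ne_zero] at h
  rw [isUnit_iff_ne_zero]
  have : (b.cartanMatrix.map (Int.cast : ℤ → ℝ)).det = (b.cartanMatrix.det : ℝ) :=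
    ((Int.castRingHom ℝ).map_det _).symm
  rw [this]
  exact_mod_cast h

open Classical in
/-- The linear combinations of the fundamental coweights outside the image of `e`. -/
def coweightCombination (V : Type*) [AddCommGroup V] [Module ℝ V] [Module ℂ V]
    [SMulCommClass ℝ ℂ V] : ({i // i ∉ Set.range e} → V) →ₗ[ℂ] (b.support → V) where
  toFun v i := ∑ k : {i // i ∉ Set.range e}, fundamentalCoweights b i k • v k
  map_add' v v' := by ext; simp [Finset.sum_add_distrib]
  map_smul' c v := by
    ext i
    simp only [Pi.smul_apply, RingHom.id_apply, Finset.smul_sum]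
    exact Finset.sum_congr rfl fun k _ ↦ smul_comm _ _ _

open Classical in
theorem matAct_coweightCombination {V : Type*} [AddCommGroup V] [Module ℝ V] [Module ℂ V]
    [SMulCommClass ℝ ℂ V] (v : {i // i ∉ Set.range e} → V) (i : b.support) :
    matAct b.cartanMatrix (coweightCombination b e V v) i =
      if h : i ∉ Set.range e then v ⟨i, h⟩ else 0 := by
  have h1 : matAct b.cartanMatrix (coweightCombination b e V v) i =
      ∑ k : {i // i ∉ Set.range e},
        (b.cartanMatrix.map (Int.cast : ℤ → ℝ) * fundamentalCoweights b) i k • v k := by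
    simp only [matAct_apply, coweightCombination, LinearMap.coe_mk, AddHom.coe_mk,
      Matrix.mul_apply, Finset.sum_smul, Finset.smul_sum, Matrix.map_apply, mul_smul,
      Int.cast_smul_eq_zsmul]
    exact Finset.sum_comm
  rw [h1, cartanMatrix_mul_fundamentalCoweights]
  simp only [Matrix.one_apply, ite_smul, one_smul, zero_smul]
  by_cases h : i ∉ Set.range e
  · rw [dif_pos h, Finset.sum_eq_single ⟨i, h⟩]
    · simp
    · intro k _ hk
      rw [if_neg]
      exact fun h' ↦ hk (Subtype.ext h'.symm)
    · simp
  · rw [dif_neg h]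
    refine Finset.sum_eq_zero fun k _ ↦ if_neg fun h' : i = k.1 ↦ h (h' ▸ k.2)

end Levi

section Levi

open RootPairing

variable {ι M N : Type*} [Finite ι] [AddCommGroup M] [Module ℝ M] [AddCommGroup N] [Module ℝ N]
  {P : RootPairing ι ℝ M N} [P.IsRootSystem] [P.IsCrystallographic] (b : P.Base)
  {J : Type*} [Fintype J] (e : J ↪ b.support)

open Classical in
theorem matAct_coweightCombination_apply_embedding {V : Type*} [AddCommGroup V] [Module ℝ V]
    [Module ℂ V] [SMulCommClass ℝ ℂ V] (v : {i // i ∉ Set.range e} → V) (j : J) :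
    matAct b.cartanMatrix (coweightCombination b e V v) (e j) = 0 := by
  rw [matAct_coweightCombination, dif_neg (by simp)]

open Classical in
/-- The decomposition of `ℂ² ⊗ Λ` into the part spanned by the simple coroots in the image of `e`
and the part fixed by the corresponding simple reflections. -/
def parabolicDecomposition :
    ((J → C2) × ({i // i ∉ Set.range e} → C2)) →ₗ[ℂ] (b.support → C2) :=
  (matActL (embedMatrix e)).coprod (coweightCombination b e C2)

omit [Finite ι] [P.IsRootSystem] in
open Classical in
theorem parabolicDecomposition_apply (u : (J → C2) × ({i // i ∉ Set.range e} → C2)) :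
    parabolicDecomposition b e u =
      matAct (embedMatrix e) u.1 + coweightCombination b e C2 u.2 := by
  rw [parabolicDecomposition, LinearMap.coprod_apply]
  rfl

/-- Apply the Cartan matrix. Its rows in the image of `e` kill the coweight part and leave an
invertible matrix acting on `u`; the remaining rows then read off `v`. -/
theorem parabolicDecomposition_injective : Function.Injective (parabolicDecomposition b e) := by
  classical
  rw [injective_iff_map_eq_zero]
  rintro ⟨u, v⟩ h
  rw [parabolicDecomposition_apply] at h
  have hu : u = 0 := by
    refine eq_zero_of_matAct_eq_zero (det_cartanMatrix_submatrix_ne_zero b e) ?_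
    ext1 k
    have h1 := congrFun (congrArg (matAct b.cartanMatrix) h) (e k)
    rw [map_add, Pi.add_apply, matAct_coweightCombination_apply_embedding, add_zero, map_zero,
      ← matAct_mul] at h1
    refine Eq.trans ?_ h1
    simp only [matAct_apply, Matrix.mul_apply, embedMatrix, Matrix.submatrix_apply]
    simp
  subst hu
  rw [map_zero, zero_add] at h
  have hv : v = 0 := by
    ext1 i
    have h1 := congrFun (congrArg (matAct b.cartanMatrix) h) i
    rwa [matAct_coweightCombination, dif_pos i.2, map_zero] at h1
  rw [hv]
  rfl

omit [Finite ι] [P.IsRootSystem] [P.IsCrystallographic] in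
theorem card_add_card_notMem_range {k : ℕ}
    (hk : b.support.card = Fintype.card J + k) :
    Nat.card {i // i ∉ Set.range e} = k := by
  classical
  rw [Nat.card_eq_fintype_card, Fintype.card_subtype_compl, Fintype.card_coe]
  have : Fintype.card {i // i ∈ Set.range e} = Fintype.card J :=
    (Fintype.card_congr (Equiv.ofInjective e e.injective)).symm
  omega

variable {b} in
-- The injective decomposition is an isomorphism by dimension. Of the second summand only this is
-- kept: the simple roots of the subdiagram vanish on it.
theorem exists_parabolicEquiv {k : ℕ} (hk : b.support.card = Fintype.card J + k) :
    ∃ (B : ((J → C2) × (Fin k → C2)) ≃L[ℂ] (b.support → C2)) (κ : (Fin k → C2) → (b.support → C2)),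
      (∀ y j, matAct b.cartanMatrix (κ y) (e j) = 0) ∧
      ∀ u, B u = matAct (embedMatrix e) u.1 + κ u.2 := by
  classical
  let σ : {i // i ∉ Set.range e} ≃ Fin k :=
    Finite.equivFinOfCardEq (card_add_card_notMem_range b e hk)
  let f := (parabolicDecomposition b e).comp
      ((LinearEquiv.refl ℂ (J → C2)).prodCongr (LinearEquiv.funCongrLeft ℂ C2 σ)).toLinearMap
  refine ⟨(LinearEquiv.ofInjectiveOfFinrankEq f
    ((parabolicDecomposition_injective b e).comp (LinearEquiv.injective _))
    (by simp [Module.finrank_pi_fintype, hk, add_mul])).toContinuousLinearEquiv,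
    fun y ↦ coweightCombination b e C2 (y ∘ σ),
    fun y j ↦ matAct_coweightCombination_apply_embedding b e _ j, fun u ↦ ?_⟩
  change f u = _
  rw [LinearMap.comp_apply, parabolicDecomposition_apply]
  rfl

/-! ### Stabilizers of generic points -/

omit [Finite ι] [P.IsRootSystem] [P.IsCrystallographic] in
/-- The functional on roots given by the coordinates of a coweight. -/
theorem apply_smul_eq_of_matAct_eq_self {z : b.support → ℝ} {w : P.weylGroup}
    (hw : matAct (weylMatrix b w) z = z) (x : M) :
    (∑ j, z j • P.coroot' (j : ι)) (w • x) = (∑ j, z j • P.coroot' (j : ι)) x := by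
  classical
  -- The matrix of `w⁻¹` describes the coweight map of `w`, so invariance is transferred to the
  -- inverse.
  have hw' : matAct (weylMatrix b w⁻¹) z = z := by
    conv_lhs => rw [← hw]
    rw [weylMatrix_inv_matAct]
  have key : ∀ (y : M) (f : b.support → ℝ), (∑ j, f j • P.coroot' (j : ι)) y =
      P.toLinearMap y (∑ j, f j • P.coroot (j : ι)) := by
    intro y f
    simp [coroot']
  have hn : w.1.coweightMap (∑ j, z j • P.coroot (j : ι)) = ∑ j, z j • P.coroot (j : ι) := by
    rw [map_sum]
    have h1 : ∀ j : b.support, w.1.coweightMap (z j • P.coroot (j : ι)) =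
        ∑ i, (weylMatrix b w⁻¹ i j • z j) • P.coroot (i : ι) := by
      intro j
      have := coweightMap_inv_coroot b w⁻¹ j
      rw [inv_inv] at this
      rw [map_smul, this, Finset.smul_sum]
      refine Finset.sum_congr rfl fun i _ ↦ ?_
      rw [smul_assoc, smul_comm]
    simp only [h1]
    rw [Finset.sum_comm]
    simp only [← Finset.sum_smul]
    refine Finset.sum_congr rfl fun i _ ↦ ?_
    congr 1
    exact congrFun hw' i
  rw [key, key]
  conv_rhs => rw [← hn]
  exact LinearMap.congr_fun (Hom.weight_coweight_transpose_apply P P _ w.1.toHom) x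

variable [P.IsReduced]

omit [P.IsRootSystem] [Fintype J] in
-- Pairing with `z` is a dominant functional whose zeros among the simple roots are exactly the
-- image of `e`.
theorem mem_parabolicSubgroup_of_matAct_eq_self {z : b.support → ℝ}
    (hz : ∀ j, matAct b.cartanMatrix z (e j) = 0)
    (hz' : ∀ i, i ∉ Set.range e → 0 < matAct b.cartanMatrix z i) {w : P.weylGroup}
    (hw : matAct (weylMatrix b w) z = z) : w ∈ parabolicSubgroup b e := by
  have key : ∀ i : b.support, (∑ j, z j • P.coroot' (j : ι)) (P.root i) =
      matAct b.cartanMatrix z i := by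
    intro i
    simp only [LinearMap.sum_apply, LinearMap.smul_apply, root_coroot'_eq_pairing, matAct_apply,
      ← b.algebraMap_cartanMatrixIn_apply ℤ, smul_eq_mul, algebraMap_int_eq, eq_intCast,
      zsmul_eq_mul]
    exact Finset.sum_congr rfl fun j _ ↦ mul_comm _ _
  have h := mem_closure_of_fixes_dominant b (∑ j, z j • P.coroot' (j : ι)) ?_ w
    (apply_smul_eq_of_matAct_eq_self b hw)
  · refine Subgroup.closure_mono ?_ h
    rintro _ ⟨i, hi, rfl⟩
    simp only [Set.mem_ofPred_eq, key] at hi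
    by_contra hmem
    by_cases hie : i ∈ Set.range e
    · obtain ⟨j, rfl⟩ := hie
      exact hmem ⟨j, rfl⟩
    · exact (hz' i hie).ne' hi
  · intro i hi
    have := key ⟨i, hi⟩
    simp only at this
    rw [this]
    by_cases hie : (⟨i, hi⟩ : b.support) ∈ Set.range e
    · obtain ⟨j, hj⟩ := hie
      rw [← hj, hz]
    · exact (hz' _ hie).le

omit [Fintype J] [P.IsReduced] in
-- The witness is the sum of the fundamental coweights outside the image of `e`.
theorem exists_dominant : ∃ z : b.support → ℝ, (∀ j, matAct b.cartanMatrix z (e j) = 0) ∧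
    ∀ i, i ∉ Set.range e → 0 < matAct b.cartanMatrix z i := by
  classical
  have hdet : IsUnit (b.cartanMatrix.map (Int.cast : ℤ → ℝ)).det :=
    (Matrix.isUnit_iff_isUnit_det _).1
      (IsUnit.of_mul_eq_one _ (cartanMatrix_mul_fundamentalCoweights b))
  obtain ⟨d, hd⟩ : ∃ d : b.support → ℝ, d = fun i ↦ if i ∈ Set.range e then 0 else 1 := ⟨_, rfl⟩
  have h : matAct b.cartanMatrix ((fundamentalCoweights b).mulVec d) = d := by
    have h1 : (b.cartanMatrix.map (Int.cast : ℤ → ℝ)).mulVec ((fundamentalCoweights b).mulVec d) =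
        d := by
      rw [Matrix.mulVec_mulVec, cartanMatrix_mul_fundamentalCoweights, Matrix.one_mulVec]
    have h2 : ∀ x : b.support → ℝ, matAct b.cartanMatrix x =
        (b.cartanMatrix.map (Int.cast : ℤ → ℝ)).mulVec x := by
      intro x
      ext i
      simp [matAct_apply, Matrix.mulVec, dotProduct]
    rw [h2, h1]
  refine ⟨(fundamentalCoweights b).mulVec d, fun j ↦ ?_, fun i hi ↦ ?_⟩
  · rw [h, hd]; simp
  · rw [h, hd]; simp only [if_neg hi]; exact one_pos

omit [Fintype J] in
/-- Every point supported on a subdiagram has a translate whose stabilizer is the stabilizer of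
the point in the corresponding parabolic subgroup. -/
theorem exists_translate_stabilizer (L : Submodule ℤ C2) [DiscreteTopology L] (z : b.support → C2) :
    ∃ f : b.support → C2, (∀ j, matAct b.cartanMatrix f (e j) = 0) ∧
      ∀ w : P.weylGroup, w • tensorCoord L.mkQ b (z + f) = tensorCoord L.mkQ b (z + f) ↔
        w ∈ parabolicSubgroup b e ∧ w • tensorCoord L.mkQ b z = tensorCoord L.mkQ b z := by
  classical
  obtain ⟨t, ht, ht'⟩ := exists_dominant b e
  -- The real dominant vector `t` placed along the direction `(1, 1)` of `ℂ²`: fixing `g` is the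
  -- same as fixing `t`.
  let g : b.support → C2 := fun i ↦ t i • (1 : C2)
  have hg : ∀ (m : Matrix b.support b.support ℤ) (i), matAct m g i = matAct m t i • (1 : C2) := by
    intro m i
    simp only [matAct_apply, g, Finset.sum_smul, smul_assoc]
  have hmem : ∀ w : P.weylGroup, matAct (weylMatrix b w) g - g = 0 → w ∈ parabolicSubgroup b e := by
    intro w hw
    refine mem_parabolicSubgroup_of_matAct_eq_self b e ht ht' (funext fun i ↦ ?_)
    have := congrFun hw i
    rw [Pi.sub_apply, hg, Pi.zero_apply, ← sub_smul] at this
    exact sub_eq_zero.1 ((smul_eq_zero.1 this).resolve_right one_ne_zero)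
  have := finite_weylGroup (P := P)
  have hL : Countable L := TopologicalSpace.separableSpace_iff_countable.1 inferInstance
  have hLI : Countable (b.support → L) := inferInstance
  -- For each `w` moving `g` and each lattice vector, at most one real `r` makes `w` fix `z + r g`
  -- modulo that vector. There are countably many such pairs, so some `r` avoids them all.
  have hcount : (⋃ x : P.weylGroup × (b.support → L),
      {r : ℝ | matAct (weylMatrix b x.1) g - g ≠ 0 ∧ r • (matAct (weylMatrix b x.1) g - g) =
        (fun i ↦ (x.2 i : C2)) - (matAct (weylMatrix b x.1) z - z)}).Countable := by
    refine Set.countable_iUnion fun x ↦ Set.Subsingleton.countable ?_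
    rintro r ⟨hne, hr⟩ s ⟨-, hs⟩
    have : (r - s) • (matAct (weylMatrix b x.1) g - g) = 0 := by rw [sub_smul, hr, hs, sub_self]
    exact sub_eq_zero.1 ((smul_eq_zero.1 this).resolve_right hne)
  obtain ⟨r, hr⟩ : ∃ r : ℝ, r ∉ ⋃ x : P.weylGroup × (b.support → L),
      {r : ℝ | matAct (weylMatrix b x.1) g - g ≠ 0 ∧ r • (matAct (weylMatrix b x.1) g - g) =
        (fun i ↦ (x.2 i : C2)) - (matAct (weylMatrix b x.1) z - z)} := by
    by_contra! hall
    exact Set.not_countable_univ (hcount.mono fun r _ ↦ hall r)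
  have hfix : ∀ j, matAct b.cartanMatrix (r • g) (e j) = 0 := by
    intro j
    rw [matAct_smul, Pi.smul_apply, hg, ht, zero_smul, smul_zero]
  refine ⟨r • g, hfix, fun w ↦ ?_⟩
  have key : w ∈ parabolicSubgroup b e →
      (w • tensorCoord L.mkQ b (z + r • g) = tensorCoord L.mkQ b (z + r • g) ↔
        w • tensorCoord L.mkQ b z = tensorCoord L.mkQ b z) := by
    intro hw
    rw [smul_tensorCoord_mkQ_eq_iff, smul_tensorCoord_mkQ_eq_iff, map_add,
      matAct_eq_self_of_mem_parabolicSubgroup hfix hw, add_sub_add_right_eq_sub]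
  constructor
  · intro h
    have hw : w ∈ parabolicSubgroup b e := by
      refine hmem w (by_contra fun hne ↦ hr ?_)
      rw [smul_tensorCoord_mkQ_eq_iff] at h
      refine Set.mem_iUnion.2 ⟨⟨w, fun i ↦ ⟨_, h i⟩⟩, hne, ?_⟩
      simp only
      rw [smul_sub, ← matAct_smul, map_add]
      ext1 i
      simp only [Pi.sub_apply, Pi.add_apply]
      abel
    exact ⟨hw, (key hw).1 h⟩
  · rintro ⟨hw, h⟩
    exact (key hw).2 h

end Levi

/-! ### Transporting points along an inclusion of Dynkin diagrams -/

section Inclusion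

open RootPairing

section

variable {ι M N J : Type*} [AddCommGroup M] [Module ℝ M] [AddCommGroup N] [Module ℝ N]
  {P : RootPairing ι ℝ M N} [P.IsCrystallographic] {b : P.Base} [Fintype J] {e : J ↪ b.support}

/-- In the coordinates `B`, an element of the parabolic subgroup acts on the first factor only. -/
theorem matAct_parabolicEquiv {k : ℕ} {B : ((J → C2) × (Fin k → C2)) ≃L[ℂ] (b.support → C2)}
    {κ : (Fin k → C2) → (b.support → C2)} (hκ : ∀ y j, matAct b.cartanMatrix (κ y) (e j) = 0)
    (hB : ∀ u, B u = matAct (embedMatrix e) u.1 + κ u.2) {w : P.weylGroup}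
    (hw : w ∈ parabolicSubgroup b e) {m : Matrix J J ℤ}
    (hm : weylMatrix b w * embedMatrix e = embedMatrix e * m) (u : (J → C2) × (Fin k → C2)) :
    matAct (weylMatrix b w) (B u) = B (matAct m u.1, u.2) := by
  rw [hB, hB, map_add, ← matAct_mul, hm, matAct_mul,
    matAct_eq_self_of_mem_parabolicSubgroup (hκ _) hw]

omit [P.IsCrystallographic] in
theorem smul_tensorCoord_embed_eq_iff (L : Submodule ℤ C2) {w : P.weylGroup} {m : Matrix J J ℤ}
    (hm : weylMatrix b w * embedMatrix e = embedMatrix e * m) (z : J → C2) :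
    w • tensorCoord L.mkQ b (matAct (embedMatrix e) z) =
      tensorCoord L.mkQ b (matAct (embedMatrix e) z) ↔ ∀ j, (matAct m z - z) j ∈ L := by
  rw [smul_tensorCoord_mkQ_eq_iff, ← matAct_mul, hm, matAct_mul, ← map_sub]
  constructor
  · intro h j
    have := h (e j)
    rwa [matAct_embedMatrix_apply] at this
  · exact fun h ↦ matAct_mem L _ h

end

variable {ι M N : Type*} [Finite ι] [AddCommGroup M] [Module ℝ M] [AddCommGroup N] [Module ℝ N]
  {P : RootPairing ι ℝ M N} [P.IsRootSystem] [P.IsCrystallographic] [P.IsReduced] {b : P.Base}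
  {ι' M' N' : Type*} [Finite ι'] [AddCommGroup M'] [Module ℝ M'] [AddCommGroup N'] [Module ℝ N']
  {P' : RootPairing ι' ℝ M' N'} [P'.IsRootSystem] [P'.IsCrystallographic] {b' : P'.Base}

/-- The Weyl group of a subdiagram is the corresponding parabolic subgroup. -/
theorem exists_mulEquiv_parabolicSubgroup (D : DynkinInclusion b b') :
    ∃ Φ : P.weylGroup ≃* parabolicSubgroup b' D.toEmbedding, ∀ w,
      weylMatrix b' (Φ w) * embedMatrix D.toEmbedding =
        embedMatrix D.toEmbedding * weylMatrix b w := by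
  classical
  set e := D.toEmbedding
  have hA : b'.cartanMatrix.submatrix e e = b.cartanMatrix := by
    ext i j
    exact D.cartanMatrix_apply i j
  have hlist : ∀ l : List b.support,
      weylMatrix b' (l.map fun j ↦ weylGroup.ofIdx P' (e j : ι')).prod * embedMatrix e =
        embedMatrix e * weylMatrix b (simpleWord b l) := by
    intro l
    rw [weylMatrix_list_prod_mul_embedMatrix, hA, simpleWord, map_list_prod, List.map_map]
    congr 3
    exact funext fun j ↦ (weylMatrix_ofIdx b j).symm
  have hcard : b'.support.card = Fintype.card b.support + (b'.support.card - b.support.card) := by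
    have := Fintype.card_le_of_embedding e
    simp only [Fintype.card_coe] at this ⊢
    omega
  -- An element of the parabolic subgroup is determined by its action `m` on the subdiagram's
  -- coroots, since it is trivial on the complement.
  have huniq' : ∀ (m : Matrix b.support b.support ℤ) (w w' : P'.weylGroup),
      w ∈ parabolicSubgroup b' e → w' ∈ parabolicSubgroup b' e →
      weylMatrix b' w * embedMatrix e = embedMatrix e * m →
      weylMatrix b' w' * embedMatrix e = embedMatrix e * m → w = w' := by
    intro m w w' hw hw' hm hm'
    obtain ⟨B, κ, hκ, hB⟩ := exists_parabolicEquiv e hcard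
    apply weylMatrix_injective b'
    refine matAct_ext (v := (1 : C2)) one_ne_zero fun j ↦ ?_
    obtain ⟨u, hu⟩ := B.surjective (Pi.single j 1)
    rw [← hu, matAct_parabolicEquiv hκ hB hw hm, matAct_parabolicEquiv hκ hB hw' hm']
  have huniq : ∀ w w' : P.weylGroup, embedMatrix e * weylMatrix b w =
      embedMatrix e * weylMatrix b w' → w = w' := by
    intro w w' h
    apply weylMatrix_injective b
    refine matAct_ext (v := (1 : C2)) one_ne_zero fun j ↦ ?_
    apply matAct_embedMatrix_injective e
    rw [← matAct_mul, ← matAct_mul, h]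
  have hex : ∀ w : P.weylGroup, ∃ w' : parabolicSubgroup b' e,
      weylMatrix b' w' * embedMatrix e = embedMatrix e * weylMatrix b w := by
    intro w
    obtain ⟨l, rfl⟩ := exists_simpleWord b w
    refine ⟨⟨_, Subgroup.list_prod_mem _ fun x hx ↦ ?_⟩, hlist l⟩
    obtain ⟨j, -, rfl⟩ := List.mem_map.1 hx
    exact ofIdx_mem_parabolicSubgroup b' j
  choose φ hφ using hex
  -- By uniqueness the choices `φ` are multiplicative; a word in the generators gives surjectivity.
  let Φ : P.weylGroup →* parabolicSubgroup b' e := MonoidHom.mk' φ fun v w ↦ by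
    apply Subtype.ext
    refine huniq' _ _ _ (φ (v * w)).2 (φ v * φ w).2 (hφ _) ?_
    rw [Subgroup.coe_mul, map_mul, Matrix.mul_assoc, hφ, ← Matrix.mul_assoc, hφ, Matrix.mul_assoc,
      ← map_mul]
  refine ⟨MulEquiv.ofBijective Φ ⟨fun v w h ↦ ?_, fun w' ↦ ?_⟩, hφ⟩
  · apply huniq
    rw [← hφ, ← hφ]
    exact congrArg (fun x : parabolicSubgroup b' e ↦ weylMatrix b' x * embedMatrix e) h
  · obtain ⟨l, hl⟩ := exists_list_of_mem_parabolicSubgroup w'.2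
    refine ⟨simpleWord b l, Subtype.ext (huniq' _ _ _ (φ _).2 w'.2 (hφ _) ?_)⟩
    rw [← hlist, hl]

/-- The point `p'` is the image of `p` under `Λ → Λ'`, moved by a generic vector fixed by the
parabolic subgroup. `Φ` matches the stabilizers and `B` intertwines their actions. -/
theorem exists_point_of_dynkinInclusion [P'.IsReduced] (L : Submodule ℤ C2) [DiscreteTopology L]
    (D : DynkinInclusion b b') (l k : ℕ) (hl : b.support.card = l)
    (hk : b'.support.card = l + k) (p : (C2 ⧸ L) ⊗[ℤ] CorootLattice P) :
    ∃ p' : (C2 ⧸ L) ⊗[ℤ] CorootLattice P',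
      Nonempty (MulAction.stabilizer P'.weylGroup p' ≃* MulAction.stabilizer P.weylGroup p) ∧
      (torusQuotient L b').LocallyModeledOn (Quotient.mk _ p')
        (AnalyticStructure.quotientProd
          (linearQuotientMap b (MulAction.stabilizer P.weylGroup p)) (Fin k → C2))
        (Quotient.mk _ 0, 0) := by
  obtain ⟨z, rfl⟩ := tensorCoord_surjective _ b L.mkQ_surjective p
  set e := D.toEmbedding with he
  obtain ⟨Φ, hΦ⟩ := exists_mulEquiv_parabolicSubgroup D
  obtain ⟨f, hf, hstab⟩ := exists_translate_stabilizer b' e L (matAct (embedMatrix e) z)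
  obtain ⟨B, κ, hκ, hB⟩ := exists_parabolicEquiv e (k := k) (by simp [hk, hl])
  have hfix : ∀ w, (Φ w : P'.weylGroup) •
      tensorCoord L.mkQ b' (matAct (embedMatrix e) z + f) =
        tensorCoord L.mkQ b' (matAct (embedMatrix e) z + f) ↔
      w • tensorCoord L.mkQ b z = tensorCoord L.mkQ b z := by
    intro w
    rw [hstab, smul_tensorCoord_embed_eq_iff L (hΦ w), smul_tensorCoord_mkQ_eq_iff]
    exact and_iff_right (Φ w).2
  have hfix' : ∀ w', ∀ hw' : w' • tensorCoord L.mkQ b' (matAct (embedMatrix e) z + f) =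
        tensorCoord L.mkQ b' (matAct (embedMatrix e) z + f),
      Φ.symm ⟨w', ((hstab w').1 hw').1⟩ • tensorCoord L.mkQ b z = tensorCoord L.mkQ b z := by
    intro w' hw'
    rw [← hfix, MulEquiv.apply_symm_apply]
    exact hw'
  refine ⟨tensorCoord L.mkQ b' (matAct (embedMatrix e) z + f), ⟨?_⟩, ?_⟩
  · exact
      { toFun := fun x ↦ ⟨Φ.symm ⟨x.1, ((hstab x.1).1 x.2).1⟩, hfix' x.1 x.2⟩
        invFun := fun y ↦ ⟨Φ y.1, (hfix y.1).2 y.2⟩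
        left_inv := fun x ↦ by simp
        right_inv := fun y ↦ by simp
        map_mul' := fun x y ↦ by
          apply Subtype.ext
          exact map_mul Φ.symm ⟨x.1, ((hstab x.1).1 x.2).1⟩ ⟨y.1, ((hstab y.1).1 y.2).1⟩ }
  · have hρ := isHolQuotientMap_linearQuotientMap b
      (MulAction.stabilizer P.weylGroup (tensorCoord L.mkQ b z))
    rw [quotientProd_eq_quotient hρ]
    have h0 : ((Quotient.mk _ 0, 0) : MulAction.orbitRel.Quotient _ _ × (Fin k → C2)) =
        Prod.map (linearQuotientMap b (MulAction.stabilizer P.weylGroup (tensorCoord L.mkQ b z)))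
          id 0 := by
      refine Prod.ext (congrArg (Quotient.mk _) ?_) rfl
      simp [tensorCoord]
    rw [h0]
    refine torusQuotient_locallyModeledOn L b' _ hρ.prodMap B fun u v ↦ ?_
    rw [Prod.map_apply', Prod.map_apply', Prod.mk.injEq, linearQuotientMap_eq_iff]
    constructor
    · rintro ⟨⟨w, hw, huv⟩, huv'⟩
      refine ⟨Φ w, (hfix w).2 hw, ?_⟩
      rw [matAct_parabolicEquiv hκ hB (Φ w).2 (hΦ w), huv]
      congr 1
      exact Prod.ext rfl huv'
    · rintro ⟨w', hw', huv⟩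
      have hw : (Φ (Φ.symm ⟨w', ((hstab w').1 hw').1⟩) : P'.weylGroup) = w' := by
        rw [MulEquiv.apply_symm_apply]
      have h1 := hΦ (Φ.symm ⟨w', ((hstab w').1 hw').1⟩)
      rw [hw] at h1
      rw [matAct_parabolicEquiv hκ hB ((hstab w').1 hw').1 h1] at huv
      have h2 := B.injective huv
      have h3 : u.2 = v.2 := (Prod.ext_iff.1 h2).2
      exact ⟨⟨_, hfix' w' hw', congrArg Prod.fst h2⟩, h3⟩

end Inclusion

/-! ### Subdiagrams of finite Dynkin diagrams -/

/-- The properties of Cartan matrices of finite type used in their classification. -/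
structure IsFiniteCartan {I : Type*} [Fintype I] [DecidableEq I] (A : Matrix I I ℤ) : Prop where
  diag : ∀ i, A i i = 2
  nonpos : ∀ i j, i ≠ j → A i j ≤ 0
  zero_symm : ∀ i j, A i j = 0 → A j i = 0
  posDef : ∃ d : I → ℤ, (∀ i, 0 < d i) ∧ (Matrix.diagonal d * A).PosDef

/-- `C` is the Cartan matrix of a full subdiagram. -/
def HasSubdiagram {I : Type*} (A : Matrix I I ℤ) {n : ℕ} (C : Matrix (Fin n) (Fin n) ℤ) : Prop :=
  ∃ f : Fin n ↪ I, ∀ i j, A (f i) (f j) = C i j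

/-- The Cartan matrix of type `B₃`. -/
def cartanB3 : Matrix (Fin 3) (Fin 3) ℤ := !![2, -1, 0; -1, 2, -2; 0, -1, 2]

/-- The Cartan matrix of type `D₄`. -/
def cartanD4 : Matrix (Fin 4) (Fin 4) ℤ :=
  !![2, -1, 0, 0; -1, 2, -1, -1; 0, -1, 2, 0; 0, -1, 0, 2]

/-- The Cartan matrix of type `G₂`. -/
def cartanG2 : Matrix (Fin 2) (Fin 2) ℤ := !![2, -3; -1, 2]

/-- The vertices `f 0, …, f (n - 1)` form a chain with simple edges, except that the last edge has
multiplicity `t` with its arrow pointing away from the last vertex. -/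
def IsDynkinChain {I : Type*} (A : Matrix I I ℤ) (n : ℕ) (t : ℤ) (f : ℕ → I) : Prop :=
  ∀ i j, i < n → j < n → A (f i) (f j) =
    if i = j then 2 else if i + 1 = j then -1
    else if j + 1 = i then (if i + 1 = n then -t else -1) else 0

/-! ### Constraints from positive definiteness -/

namespace IsFiniteCartan

variable {I : Type*} [Fintype I] [DecidableEq I] {A : Matrix I I ℤ} (hA : IsFiniteCartan A)

include hA

theorem neg_of_ne {i j : I} (hij : i ≠ j) (h : A i j ≠ 0) : A i j ≤ -1 := by
  have := hA.nonpos i j hij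
  omega

theorem ne_symm {i j : I} (h : A i j ≠ 0) : A j i ≠ 0 := fun h' ↦ h (hA.zero_symm _ _ h')

/-- There is no nonnegative vector mapped to a vector that is nonpositive on its support. -/
theorem false_of_nonneg (c : I → ℤ) (hc : ∀ i, 0 ≤ c i) (hc0 : ∃ i, 0 < c i)
    (h : ∀ i, 0 < c i → ∃ T : Finset I, i ∈ T ∧ ∑ j ∈ T, A i j * c j ≤ 0) : False := by
  obtain ⟨d, hd, hpos⟩ := hA.posDef
  obtain ⟨i₀, hi₀⟩ := hc0
  have h1 := hpos.dotProduct_mulVec_pos (x := c) (fun h0 ↦ by simp [h0] at hi₀)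
  refine absurd h1 (not_lt.2 ?_)
  rw [← Matrix.mulVec_mulVec, dotProduct]
  refine Finset.sum_nonpos fun i _ ↦ ?_
  rw [Matrix.mulVec_diagonal, Pi.star_apply, star_trivial]
  rcases (hc i).eq_or_lt with h0 | h0
  · simp [← h0]
  · refine mul_nonpos_of_nonneg_of_nonpos h0.le (mul_nonpos_of_nonneg_of_nonpos (hd i).le ?_)
    obtain ⟨T, hiT, hT⟩ := h i h0
    refine le_trans ?_ hT
    rw [Matrix.mulVec, dotProduct]
    have hsplit := Finset.sum_sdiff (f := fun j ↦ A i j * c j) (Finset.subset_univ T)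
    rw [← hsplit]
    -- Terms outside `T` are off-diagonal, hence nonpositive, so a partial sum of the row suffices.
    refine add_le_of_nonpos_left (Finset.sum_nonpos fun j hj ↦ ?_)
    refine mul_nonpos_of_nonpos_of_nonneg (hA.nonpos i j ?_) (hc j)
    rintro rfl
    exact (Finset.mem_sdiff.1 hj).2 hiT

/-- A finite diagram has no vertices forming a cycle. -/
theorem false_of_forall_two_neighbors (S : Set I) (hS : S.Nonempty)
    (h : ∀ i ∈ S, ∃ j ∈ S, ∃ k ∈ S, j ≠ i ∧ k ≠ i ∧ j ≠ k ∧ A i j ≠ 0 ∧ A i k ≠ 0) : False := by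
  classical
  -- The test vector is the indicator of `S`: each row contains a 2 and two entries that are at most
  -- -1.
  refine hA.false_of_nonneg (fun i ↦ if i ∈ S then 1 else 0) (fun i ↦ by split_ifs <;> simp) ?_ ?_
  · obtain ⟨i, hi⟩ := hS
    exact ⟨i, by simp [hi]⟩
  · intro i hi
    have hi' : i ∈ S := by
      by_contra h'
      simp [h'] at hi
    obtain ⟨j, hj, k, hk, hji, hki, hjk, haj, hak⟩ := h i hi'
    refine ⟨{i, j, k}, by simp, ?_⟩
    rw [Finset.sum_insert (by simp [hji.symm, hki.symm]), Finset.sum_insert (by simpa using hjk),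
      Finset.sum_singleton]
    simp only [hi', hj, hk, if_true, mul_one, hA.diag]
    have := hA.neg_of_ne hji.symm haj
    have := hA.neg_of_ne hki.symm hak
    omega

/-- The multiplicities of two edges at a vertex of a finite diagram add up to less than four. -/
theorem mul_add_mul_lt_four {o x y : I} (hx : x ≠ o) (hy : y ≠ o) (hxy : x ≠ y)
    (hox : A o x ≠ 0) (hoy : A o y ≠ 0) :
    A o x * A x o + A o y * A y o < 4 := by
  by_contra! hge
  have hxo := hA.neg_of_ne hx (hA.ne_symm hox)
  have hyo := hA.neg_of_ne hy (hA.ne_symm hoy)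
  -- With 2 at the centre and `-A x o` at each neighbor, the neighbor rows vanish and the central
  -- row is 4 minus the sum of the multiplicities.
  refine hA.false_of_nonneg
    (fun i ↦ if i = o then 2 else if i = x then -A x o else if i = y then -A y o else 0)
    (fun i ↦ by split_ifs <;> omega) ⟨o, by simp⟩ fun i hi ↦ ?_
  by_cases hio : i = o
  · subst hio
    refine ⟨{i, x, y}, by simp, ?_⟩
    rw [Finset.sum_insert (by simp [hx.symm, hy.symm]), Finset.sum_insert (by simpa using hxy),
      Finset.sum_singleton]
    simp only [if_true, hx, hy, hxy.symm, if_false, hA.diag]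
    linarith
  · refine ⟨{i, o}, by simp, ?_⟩
    rw [Finset.sum_insert (by simpa using hio), Finset.sum_singleton]
    simp only [hio, if_false, if_true, hA.diag] at hi ⊢
    split_ifs at hi ⊢ with h1 h2
    · subst h1; linarith
    · subst h2; linarith
    · simp at hi

/-- The same test vector, with a single neighbor. -/
theorem mul_lt_four {o x : I} (hx : x ≠ o) : A o x * A x o < 4 := by
  by_cases h : A o x = 0
  · simp [h]
  by_contra! hge
  have hxo := hA.neg_of_ne hx (hA.ne_symm h)
  refine hA.false_of_nonneg (fun i ↦ if i = o then 2 else if i = x then -A x o else 0)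
    (fun i ↦ by split_ifs <;> omega) ⟨o, by simp⟩ fun i hi ↦ ?_
  by_cases hio : i = o
  · subst hio
    refine ⟨{i, x}, by simp, ?_⟩
    rw [Finset.sum_insert (by simpa using hx.symm), Finset.sum_singleton]
    simp only [if_true, hx, if_false, hA.diag]
    linarith
  · refine ⟨{i, o}, by simp, ?_⟩
    rw [Finset.sum_insert (by simpa using hio), Finset.sum_singleton]
    simp only [hio, if_false, if_true, hA.diag] at hi ⊢
    split_ifs at hi ⊢ with h1
    · subst h1; linarith
    · simp at hi

/-- A vertex of a finite diagram with three neighbors has simple edges. -/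
theorem mul_add_mul_add_mul_lt_four {o x y z : I} (hx : x ≠ o) (hy : y ≠ o) (hz : z ≠ o)
    (hxy : x ≠ y) (hxz : x ≠ z) (hyz : y ≠ z)
    (hox : A o x ≠ 0) (hoy : A o y ≠ 0) (hoz : A o z ≠ 0) :
    A o x * A x o + A o y * A y o + A o z * A z o < 4 := by
  by_contra! hge
  have hxo := hA.neg_of_ne hx (hA.ne_symm hox)
  have hyo := hA.neg_of_ne hy (hA.ne_symm hoy)
  have hzo := hA.neg_of_ne hz (hA.ne_symm hoz)
  refine hA.false_of_nonneg
    (fun i ↦ if i = o then 2 else if i = x then -A x o else if i = y then -A y o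
      else if i = z then -A z o else 0)
    (fun i ↦ by split_ifs <;> omega) ⟨o, by simp⟩ fun i hi ↦ ?_
  by_cases hio : i = o
  · subst hio
    refine ⟨{i, x, y, z}, by simp, ?_⟩
    rw [Finset.sum_insert (by simp [hx.symm, hy.symm, hz.symm]),
      Finset.sum_insert (by simp [hxy, hxz]), Finset.sum_insert (by simpa using hyz),
      Finset.sum_singleton]
    simp only [if_true, hx, hy, hz, hxy.symm, hxz.symm, hyz.symm, if_false, hA.diag]
    linarith
  · refine ⟨{i, o}, by simp, ?_⟩
    rw [Finset.sum_insert (by simpa using hio), Finset.sum_singleton]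
    simp only [hio, if_false, if_true, hA.diag] at hi ⊢
    split_ifs at hi ⊢ with h1 h2 h3
    · subst h1; linarith
    · subst h2; linarith
    · subst h3; linarith
    · simp at hi

/-- The possible edges of a finite diagram. -/
theorem edge_cases {x y : I} (hxy : x ≠ y) (h : A x y ≠ 0) :
    (A x y = -1 ∧ A y x = -1) ∨ (A x y = -1 ∧ A y x = -2) ∨ (A x y = -2 ∧ A y x = -1) ∨
      (A x y = -1 ∧ A y x = -3) ∨ (A x y = -3 ∧ A y x = -1) := by
  have h1 := hA.neg_of_ne hxy h
  have h2 := hA.neg_of_ne hxy.symm (hA.ne_symm h)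
  have h3 := hA.mul_lt_four hxy.symm
  have h4 : -3 ≤ A x y := by nlinarith
  have h5 : -3 ≤ A y x := by nlinarith
  generalize A x y = a at *
  generalize A y x = c at *
  interval_cases a <;> interval_cases c <;> simp_all

end IsFiniteCartan

namespace IsFiniteCartan

variable {I : Type*} [Fintype I] [DecidableEq I] {A : Matrix I I ℤ} (hA : IsFiniteCartan A)

include hA

theorem hasSubdiagram {n : ℕ} {C : Matrix (Fin n) (Fin n) ℤ} (f : Fin n → I)
    (hC : ∀ i j, i ≠ j → C i j ≤ 0) (h : ∀ i j, A (f i) (f j) = C i j) : HasSubdiagram A C := by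
  refine ⟨⟨f, fun i j hij ↦ ?_⟩, h⟩
  by_contra hne
  have h1 := h i j
  rw [hij, hA.diag] at h1
  have := hC i j hne
  omega

theorem hasSubdiagram_cartanB3 {x y z : I} (hxy : A x y = -1) (hyx : A y x = -1)
    (hyz : A y z = -2) (hzy : A z y = -1) (hxz : A x z = 0) : HasSubdiagram A cartanB3 := by
  have hzx := hA.zero_symm _ _ hxz
  refine hA.hasSubdiagram ![x, y, z] (fun i j hij ↦ by
    fin_cases i <;> fin_cases j <;> simp_all [cartanB3]) fun i j ↦ ?_
  fin_cases i <;> fin_cases j <;> simp [cartanB3, hA.diag, *]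

theorem hasSubdiagram_cartanD4 {x y z w : I} (hxy : A x y = -1) (hyx : A y x = -1)
    (hyz : A y z = -1) (hzy : A z y = -1) (hyw : A y w = -1) (hwy : A w y = -1)
    (hxz : A x z = 0) (hxw : A x w = 0) (hzw : A z w = 0) : HasSubdiagram A cartanD4 := by
  have hzx := hA.zero_symm _ _ hxz
  have hwx := hA.zero_symm _ _ hxw
  have hwz := hA.zero_symm _ _ hzw
  refine hA.hasSubdiagram ![x, y, z, w] (fun i j hij ↦ by
    fin_cases i <;> fin_cases j <;> simp_all [cartanD4]) fun i j ↦ ?_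
  fin_cases i <;> fin_cases j <;> simp [cartanD4, hA.diag, *]

theorem hasSubdiagram_cartanG2 {x y : I} (hxy : A x y = -3) (hyx : A y x = -1) :
    HasSubdiagram A cartanG2 := by
  refine hA.hasSubdiagram ![x, y] (fun i j hij ↦ by
    fin_cases i <;> fin_cases j <;> simp_all [cartanG2]) fun i j ↦ ?_
  fin_cases i <;> fin_cases j <;> simp [cartanG2, hA.diag, *]

/-! ### Chains of vertices and their extensions -/

section Chain

variable {n : ℕ} {t : ℤ} {f : ℕ → I} (hf : IsDynkinChain A n t f) (ht : t = 1 ∨ t = 2)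

include hf ht

theorem chain_injective {i j : ℕ} (hi : i < n) (hj : j < n) (hij : i ≠ j) : f i ≠ f j := by
  intro h
  have h1 := hf i j hi hj
  rw [h, hA.diag, if_neg hij] at h1
  split_ifs at h1 <;> omega

omit [Fintype I] [DecidableEq I] hA ht in
theorem chain_succ {i : ℕ} (hi : i + 1 < n) : A (f i) (f (i + 1)) = -1 := by
  rw [hf i (i + 1) (by omega) hi, if_neg (by omega), if_pos rfl]

omit [Fintype I] [DecidableEq I] hA in
theorem chain_succ_ne_zero {i : ℕ} (hi : i + 1 < n) : A (f (i + 1)) (f i) ≠ 0 := by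
  rw [hf (i + 1) i hi (by omega), if_neg (by omega), if_neg (by omega), if_pos rfl]
  split_ifs <;> omega

omit [Fintype I] [DecidableEq I] hA ht in
theorem chain_succ_of_lt {i : ℕ} (hi : i + 2 < n) : A (f (i + 1)) (f i) = -1 := by
  rw [hf (i + 1) i (by omega) (by omega), if_neg (by omega), if_neg (by omega), if_pos rfl,
    if_neg (by omega)]

omit [Fintype I] [DecidableEq I] hA ht in
theorem chain_last {i : ℕ} (hi : i + 2 = n) : A (f (i + 1)) (f i) = -t := by
  rw [hf (i + 1) i (by omega) (by omega), if_neg (by omega), if_neg (by omega), if_pos rfl,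
    if_pos (by omega)]

omit [Fintype I] [DecidableEq I] hA ht in
theorem chain_eq_zero {i j : ℕ} (hi : i < n) (hj : j < n) (h1 : i ≠ j) (h2 : i + 1 ≠ j)
    (h3 : j + 1 ≠ i) : A (f i) (f j) = 0 := by
  rw [hf i j hi hj, if_neg h1, if_neg h2, if_neg h3]

/-- With two neighbors on the chain, `x` would close the segment between them into a cycle. -/
theorem chain_neighbor_unique {x : I} (hx : ∀ i < n, f i ≠ x) {i j : ℕ} (hi : i < j) (hj : j < n)
    (hxi : A x (f i) ≠ 0) (hxj : A x (f j) ≠ 0) : False := by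
  refine hA.false_of_forall_two_neighbors ({x} ∪ {y | ∃ s, i ≤ s ∧ s ≤ j ∧ f s = y})
    ⟨x, by simp⟩ ?_
  have hmem : ∀ s, i ≤ s → s ≤ j → f s ∈ ({x} ∪ {y | ∃ s, i ≤ s ∧ s ≤ j ∧ f s = y} : Set I) :=
    fun s h1 h2 ↦ Or.inr ⟨s, h1, h2, rfl⟩
  rintro y (rfl | ⟨s, h1, h2, rfl⟩)
  · exact ⟨f i, hmem i le_rfl hi.le, f j, hmem j hi.le le_rfl, hx i (by omega), hx j hj,
      hA.chain_injective hf ht (by omega) hj hi.ne, hxi, hxj⟩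
  · rcases h1.eq_or_lt with rfl | h1
    · refine ⟨x, by simp, f (i + 1), hmem _ (by omega) (by omega), (hx i (by omega)).symm,
        hA.chain_injective hf ht (by omega) (by omega) (by omega), (hx (i + 1) (by omega)).symm,
        hA.ne_symm hxi, ?_⟩
      rw [chain_succ hf (by omega)]
      decide
    · obtain ⟨s, rfl⟩ : ∃ r, s = r + 1 := ⟨s - 1, by omega⟩
      rcases h2.eq_or_lt with rfl | h2
      · exact ⟨x, by simp, f s, hmem _ (by omega) (by omega), (hx _ hj).symm,
          hA.chain_injective hf ht (by omega) (by omega) (by omega), (hx s (by omega)).symm,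
          hA.ne_symm hxj, chain_succ_ne_zero hf ht hj⟩
      · refine ⟨f (s + 1 + 1), hmem _ (by omega) (by omega), f s, hmem _ (by omega) (by omega),
          hA.chain_injective hf ht (by omega) (by omega) (by omega),
          hA.chain_injective hf ht (by omega) (by omega) (by omega),
          hA.chain_injective hf ht (by omega) (by omega) (by omega), ?_,
          chain_succ_ne_zero hf ht (by omega)⟩
        rw [chain_succ hf (by omega)]
        decide

omit [Fintype I] [DecidableEq I] hA ht hf in
/-- Extend a chain by a vertex at its end. -/
theorem chain_snoc (hA : ∀ i, A i i = 2) (hf : IsDynkinChain A n 1 f) {x : I} {t : ℤ}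
    (hxf : ∀ i, i + 1 < n → A x (f i) = 0) (hfx : ∀ i, i + 1 < n → A (f i) x = 0)
    (h1 : ∀ i, i + 1 = n → A (f i) x = -1) (h2 : ∀ i, i + 1 = n → A x (f i) = -t) :
    IsDynkinChain A (n + 1) t (fun i ↦ if i = n then x else f i) := by
  intro i j hi hj
  by_cases hin : i = n
  · subst hin
    by_cases hji : j = i
    · subst hji; simp [hA]
    · by_cases hj1 : j + 1 = i
      · simp [hji, Ne.symm hji, hj1, h2 j hj1]
        omega
      · simp [hji, Ne.symm hji, hj1, hxf j (by omega)]
        omega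
  · by_cases hjn : j = n
    · subst hjn
      by_cases hi1 : i + 1 = j
      · simp [hin, hi1, h1 i hi1]
      · simp [hin, hi1, hfx i (by omega)]
        omega
    · have := hf i j (by omega) (by omega)
      simp only [hin, hjn, if_false, this]
      split_ifs <;> omega

omit [Fintype I] [DecidableEq I] hA ht hf in
/-- Extend a chain by a vertex at its beginning. -/
theorem chain_cons (hA : ∀ i, A i i = 2) (hf : IsDynkinChain A n t f) (hn : 2 ≤ n) {x : I}
    (hxf : ∀ i, i ≠ 0 → i < n → A x (f i) = 0) (hfx : ∀ i, i ≠ 0 → i < n → A (f i) x = 0)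
    (h1 : A (f 0) x = -1) (h2 : A x (f 0) = -1) :
    IsDynkinChain A (n + 1) t (fun i ↦ if i = 0 then x else f (i - 1)) := by
  intro i j hi hj
  rcases i with _ | i
  · rcases j with _ | j
    · simp [hA]
    · rcases eq_or_ne j 0 with rfl | hj0
      · simp [h2]
      · simp [hxf j hj0 (by omega)]
        omega
  · rcases j with _ | j
    · rcases eq_or_ne i 0 with rfl | hi0
      · simp [h1]
        omega
      · simp [hfx i hi0 (by omega)]
        omega
    · have := hf i j (by omega) (by omega)
      simp [this]

omit [Fintype I] [DecidableEq I] hA ht hf in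
theorem chain_reverse (hf : IsDynkinChain A n 1 f) :
    IsDynkinChain A n 1 (fun i ↦ f (n - 1 - i)) := by
  intro i j hi hj
  have := hf (n - 1 - i) (n - 1 - j) (by omega) (by omega)
  simp only [this]
  split_ifs <;> omega

end Chain

/-- Extend a simply laced chain by a vertex adjacent to its end. -/
theorem exists_extension_last {n : ℕ} {f : ℕ → I} (hf : IsDynkinChain A (n + 1) 1 f) {x : I}
    (hx : f n ≠ x) (hxn : A x (f n) ≠ 0) (hz : ∀ j < n, A x (f j) = 0) :
    HasSubdiagram A cartanB3 ∨ HasSubdiagram A cartanG2 ∨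
      ∃ t' f', (t' = 1 ∨ t' = 2) ∧ IsDynkinChain A (n + 1 + 1) t' f' := by
  have hz' : ∀ j < n, A (f j) x = 0 := fun j hj ↦ hA.zero_symm _ _ (hz j hj)
  have hsnoc : ∀ t, A (f n) x = -1 → A x (f n) = -t →
      ∃ f', IsDynkinChain A (n + 1 + 1) t f' := fun t h1 h2 ↦
    ⟨_, chain_snoc hA.diag hf (fun i hi ↦ hz i (by omega)) (fun i hi ↦ hz' i (by omega))
      (fun i hi ↦ by obtain rfl : i = n := by omega
                     exact h1)
      (fun i hi ↦ by obtain rfl : i = n := by omega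
                     exact h2)⟩
  rcases hA.edge_cases hx.symm hxn with ⟨h1, h2⟩ | ⟨h1, h2⟩ | ⟨h1, h2⟩ | ⟨h1, h2⟩ | ⟨h1, h2⟩
  · obtain ⟨f', hf'⟩ := hsnoc 1 h2 h1
    exact Or.inr (Or.inr ⟨1, f', Or.inl rfl, hf'⟩)
  -- This double edge has the wrong direction for type `C`. On a single vertex, exchanging the two
  -- ends repairs this; on a longer chain it produces `B₃`.
  · rcases n with _ | n
    · refine Or.inr (Or.inr ⟨2, fun i ↦ if i = 0 then x else f 0, Or.inr rfl, fun i j hi hj ↦ ?_⟩)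
      have hi' : i = 0 ∨ i = 1 := by omega
      have hj' : j = 0 ∨ j = 1 := by omega
      rcases hi' with rfl | rfl <;> rcases hj' with rfl | rfl <;> simp [hA.diag, h1, h2]
    · refine Or.inl (hA.hasSubdiagram_cartanB3 (chain_succ hf (by omega))
        ?_ h2 h1 (hz' n (by omega)))
      exact chain_last hf (by omega)
  · obtain ⟨f', hf'⟩ := hsnoc 2 h2 h1
    exact Or.inr (Or.inr ⟨2, f', Or.inr rfl, hf'⟩)
  · exact Or.inr (Or.inl (hA.hasSubdiagram_cartanG2 h2 h1))
  · exact Or.inr (Or.inl (hA.hasSubdiagram_cartanG2 h1 h2))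

/-- A finite diagram contains no chain with double edges at both ends. -/
theorem chain_false_of_double {n : ℕ} {f : ℕ → I} (hf : IsDynkinChain A (n + 2) 2 f) {x : I}
    (hx : ∀ i < n + 2, f i ≠ x) (h2 : A x (f 0) * A (f 0) x = 2) (hx0 : A x (f 0) ≤ -1) :
    False := by
  classical
  -- The test vector is 2 along the chain and `-A x (f 0)` at `x`; every partial row sum used below
  -- is then 0.
  have hcf : ∀ i < n + 2, (if f i = x then -A x (f 0) else
      if ∃ s < n + 2, f s = f i then (2 : ℤ) else 0) = 2 := fun i hi ↦ by
    rw [if_neg (hx i hi), if_pos ⟨i, hi, rfl⟩]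
  refine hA.false_of_nonneg (fun i ↦ if i = x then -A x (f 0) else
    if ∃ s < n + 2, f s = i then 2 else 0) (fun i ↦ by split_ifs <;> omega)
    ⟨f 0, by simp only [hcf 0 (by omega)]; decide⟩ fun y hy ↦ ?_
  have hinj : ∀ i j, i < n + 2 → j < n + 2 → i ≠ j → f i ≠ f j := fun i j hi hj hij ↦
    hA.chain_injective hf (Or.inr rfl) hi hj hij
  by_cases hyx : y = x
  · subst hyx
    refine ⟨{y, f 0}, by simp, ?_⟩
    rw [Finset.sum_insert (by simpa using (hx 0 (by omega)).symm), Finset.sum_singleton]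
    simp only [hcf 0 (by omega), if_true, hA.diag]
    linarith
  · by_cases hys : ∃ s < n + 2, f s = y
    · obtain ⟨s, hs, rfl⟩ := hys
      rcases s with _ | s
      · refine ⟨{f 0, x, f 1}, by simp, ?_⟩
        rw [Finset.sum_insert (by simp [hx 0 (by omega), hinj 0 1 (by omega) (by omega)]),
          Finset.sum_insert (by simpa using (hx 1 (by omega)).symm), Finset.sum_singleton]
        simp only [hcf 0 (by omega), hcf 1 (by omega), if_true, hA.diag]
        have := chain_succ hf (i := 0) (by omega)
        simp only [zero_add] at this
        rw [this]
        linarith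
      · rcases (show s + 2 ≤ n + 2 by omega).eq_or_lt with hlast | hlt
        · refine ⟨{f (s + 1), f s}, by simp, ?_⟩
          rw [Finset.sum_insert (by simpa using hinj (s + 1) s hs (by omega) (by omega)),
            Finset.sum_singleton]
          simp only [hcf (s + 1) hs, hcf s (by omega), hA.diag]
          rw [chain_last hf (by omega)]
          norm_num
        · refine ⟨{f (s + 1), f s, f (s + 1 + 1)}, by simp, ?_⟩
          rw [Finset.sum_insert (by
              simp [hinj (s + 1) s hs (by omega), hinj (s + 1) (s + 1 + 1) hs (by omega)]),
            Finset.sum_insert (by simpa using hinj s (s + 1 + 1) (by omega) (by omega) (by omega)),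
            Finset.sum_singleton]
          simp only [hcf (s + 1) hs, hcf s (by omega), hcf (s + 1 + 1) (by omega), hA.diag]
          rw [chain_succ_of_lt hf (by omega), chain_succ hf (by omega)]
          norm_num
    · simp [hyx, hys] at hy

/-- The new vertex meets the chain in one place only. At an interior vertex it creates a branching,
which is `D₄` (or `B₃` next to a double edge); at an end it lengthens the chain, gives `B₃` or `G₂`,
or contradicts finiteness. -/
theorem exists_extension {n : ℕ} {t : ℤ} {f : ℕ → I} (hf : IsDynkinChain A n t f)
    (ht : t = 1 ∨ t = 2) {x : I} (hx : ∀ i < n, f i ≠ x) {i : ℕ} (hi : i < n)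
    (hxi : A x (f i) ≠ 0) :
    HasSubdiagram A cartanB3 ∨ HasSubdiagram A cartanD4 ∨ HasSubdiagram A cartanG2 ∨
      ∃ t' f', (t' = 1 ∨ t' = 2) ∧ IsDynkinChain A (n + 1) t' f' := by
  have hz : ∀ j < n, j ≠ i → A x (f j) = 0 := by
    intro j hj hji
    by_contra hxj
    rcases lt_or_gt_of_ne hji with h | h
    · exact hA.chain_neighbor_unique hf ht hx h hi hxj hxi
    · exact hA.chain_neighbor_unique hf ht hx h hj hxi hxj
  have hz' : ∀ j < n, j ≠ i → A (f j) x = 0 := fun j hj hji ↦ hA.zero_symm _ _ (hz j hj hji)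
  have hinj : ∀ i j, i < n → j < n → i ≠ j → f i ≠ f j := fun i j hi hj hij ↦
    hA.chain_injective hf ht hi hj hij
  have hxne : x ≠ f i := (hx i hi).symm
  have hneg := hA.neg_of_ne hxne hxi
  have hneg' := hA.neg_of_ne hxne.symm (hA.ne_symm hxi)
  have hend : ∀ {m : ℕ} {g : ℕ → I}, m + 1 = n → IsDynkinChain A n 1 g → g m ≠ x →
      A x (g m) ≠ 0 → (∀ j < m, A x (g j) = 0) → HasSubdiagram A cartanB3 ∨
        HasSubdiagram A cartanD4 ∨ HasSubdiagram A cartanG2 ∨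
        ∃ t' f', (t' = 1 ∨ t' = 2) ∧ IsDynkinChain A (n + 1) t' f' := by
    rintro m g rfl hg h1 h2 h3
    rcases hA.exists_extension_last hg h1 h2 h3 with h | h | h
    · exact Or.inl h
    · exact Or.inr (Or.inr (Or.inl h))
    · exact Or.inr (Or.inr (Or.inr h))
  rcases i with _ | s
  · rcases n with _ | _ | n
    · omega
    · refine hend (m := 0) (g := f) rfl ?_ hxne.symm hxi (by omega)
      intro i j hi hj
      obtain rfl : i = 0 := by omega
      obtain rfl : j = 0 := by omega
      simp [hA.diag]
    · rcases hA.edge_cases hxne hxi with ⟨h1, h2⟩ | h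
      · refine Or.inr (Or.inr (Or.inr ⟨t, _, ht, chain_cons hA.diag hf (by omega)
          (fun i hi0 hi ↦ hz i hi hi0) (fun i hi0 hi ↦ hz' i hi hi0) h2 h1⟩))
      · rcases ht with rfl | rfl
        -- A simply laced chain can be reversed, so a multiple edge at its beginning is treated as
        -- one at its end.
        · refine hend (m := n + 1) rfl (chain_reverse hf) ?_ ?_ ?_
          · simpa using hxne.symm
          · simpa using hxi
          · intro j hj
            exact hz _ (by omega) (by omega)
        · rcases h with ⟨h1, h2⟩ | ⟨h1, h2⟩ | ⟨h1, h2⟩ | ⟨h1, h2⟩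
          · exact (hA.chain_false_of_double hf hx (by rw [h1, h2]; norm_num) hneg).elim
          · exact (hA.chain_false_of_double hf hx (by rw [h1, h2]; norm_num) hneg).elim
          · exact Or.inr (Or.inr (Or.inl (hA.hasSubdiagram_cartanG2 h2 h1)))
          · exact Or.inr (Or.inr (Or.inl (hA.hasSubdiagram_cartanG2 h1 h2)))
  · have hs1 : A (f s) (f (s + 1)) = -1 := chain_succ hf hi
    rcases (show s + 2 ≤ n by omega).eq_or_lt with hlast | hlt
    · have hs2 : A (f (s + 1)) (f s) = -t := chain_last hf hlast
      rcases ht with rfl | rfl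
      · exact hend (m := s + 1) (by omega) hf hxne.symm hxi
          fun j hj ↦ hz j (by omega) (by omega)
      -- The last edge already uses multiplicity 2, which forces the edge to `x` to be simple; this
      -- is `B₃`.
      · have hlt4 := hA.mul_add_mul_lt_four (hinj s (s + 1) (by omega) hi (by omega)) hxne
          (hx s (by omega)) (by rw [hs2]; decide) (hA.ne_symm hxi)
        rw [hs1, hs2] at hlt4
        have h1 : A x (f (s + 1)) = -1 := by nlinarith
        have h2 : A (f (s + 1)) x = -1 := by nlinarith
        exact Or.inl (hA.hasSubdiagram_cartanB3 h1 h2 hs2 hs1 (hz s (by omega) (by omega)))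
    · have hs2 : A (f (s + 1)) (f s) = -1 := chain_succ_of_lt hf hlt
      have hs3 : A (f (s + 1)) (f (s + 1 + 1)) = -1 := chain_succ hf hlt
      have hne3 := chain_succ_ne_zero hf ht (i := s + 1) hlt
      have hs4 := hA.neg_of_ne (hinj (s + 1 + 1) (s + 1) hlt hi (by omega)) hne3
      -- Three edges at one vertex are all simple.
      have hlt4 := hA.mul_add_mul_add_mul_lt_four (hinj s (s + 1) (by omega) hi (by omega))
        (hinj (s + 1 + 1) (s + 1) hlt hi (by omega)) hxne
        (hinj s (s + 1 + 1) (by omega) hlt (by omega)) (hx s (by omega)) (hx _ hlt)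
        (by rw [hs2]; decide) (by rw [hs3]; decide) (hA.ne_symm hxi)
      rw [hs1, hs2, hs3] at hlt4
      have h1 : A x (f (s + 1)) = -1 := by nlinarith
      have h2 : A (f (s + 1)) x = -1 := by nlinarith
      have h3 : A (f (s + 1 + 1)) (f (s + 1)) = -1 := by nlinarith
      refine Or.inr (Or.inl (hA.hasSubdiagram_cartanD4 hs1 hs2 hs3 h3 h2 h1
        (chain_eq_zero hf (by omega) hlt (by omega) (by omega) (by omega))
        (hz' s (by omega) (by omega)) (hz' _ hlt (by omega))))

/-- A connected finite diagram that is not of type `A` or `C` contains a full subdiagram of type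
`B₃`, `D₄` or `G₂`. -/
theorem exists_subdiagram_or [Nonempty I]
    (hconn : ∀ (p : I → Prop) (i j : I), p i → (∀ i j, p i → A j i ≠ 0 → p j) → p j) :
    HasSubdiagram A cartanB3 ∨ HasSubdiagram A cartanD4 ∨ HasSubdiagram A cartanG2 ∨
      (∃ n, ∃ e : I ≃ Fin n, ∀ i j, A i j = CartanMatrix.A n (e i) (e j)) ∨
      ∃ n, ∃ e : I ≃ Fin n, ∀ i j, A i j = CartanMatrix.C n (e i) (e j) := by
  classical
  by_contra hcon
  push Not at hcon
  obtain ⟨hB, hD, hG, hnA, hnC⟩ := hcon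
  -- If every alternative fails, chains can be extended forever, which contradicts finiteness of
  -- `I`.
  have step : ∀ n : ℕ, ∃ t f, (t = 1 ∨ t = 2) ∧ IsDynkinChain A (n + 1) t f := by
    intro n
    induction n with
    | zero =>
      refine ⟨1, fun _ ↦ Classical.arbitrary I, Or.inl rfl, fun i j hi hj ↦ ?_⟩
      obtain rfl : i = 0 := by omega
      obtain rfl : j = 0 := by omega
      simp [hA.diag]
    | succ n ih =>
      obtain ⟨t, f, ht, hf⟩ := ih
      obtain ⟨x, i, hx, hi, hxi⟩ : ∃ x i, (∀ j < n + 1, f j ≠ x) ∧ i < n + 1 ∧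
          A x (f i) ≠ 0 := by
        by_contra! hno
        -- If no outside vertex is adjacent to the chain, connectedness makes the chain the whole
        -- diagram, of type `A` for `t = 1` and of type `C` for `t = 2`.
        have hall : ∀ y, ∃ j < n + 1, f j = y := by
          intro y
          refine hconn (fun y ↦ ∃ j < n + 1, f j = y) (f 0) y ⟨0, by omega, rfl⟩ ?_
          rintro _ y ⟨j, hj, rfl⟩ hy
          by_contra! hne
          exact hy (hno y j hne hj)
        let g : Fin (n + 1) → I := fun k ↦ f k
        have hg : Function.Bijective g := by
          refine ⟨fun i j hij ↦ ?_, fun y ↦ ?_⟩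
          · by_contra hne
            exact hA.chain_injective hf ht i.2 j.2 (fun h ↦ hne (Fin.ext h)) hij
          · obtain ⟨j, hj, rfl⟩ := hall y
            exact ⟨⟨j, hj⟩, rfl⟩
        have hval : ∀ i j, A i j = A (f ((Equiv.ofBijective g hg).symm i))
            (f ((Equiv.ofBijective g hg).symm j)) := by
          intro i j
          conv_lhs => rw [← (Equiv.ofBijective g hg).apply_symm_apply i,
            ← (Equiv.ofBijective g hg).apply_symm_apply j]
          rfl
        rcases ht with rfl | rfl
        · obtain ⟨i, j, hij⟩ := hnA (n + 1) (Equiv.ofBijective g hg).symm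
          apply hij
          rw [hval, hf _ _ (Fin.is_lt _) (Fin.is_lt _)]
          simp only [CartanMatrix.A, Matrix.of_apply, Fin.ext_iff]
          split_ifs <;> first | rfl | omega
        · obtain ⟨i, j, hij⟩ := hnC (n + 1) (Equiv.ofBijective g hg).symm
          apply hij
          rw [hval, hf _ _ (Fin.is_lt _) (Fin.is_lt _)]
          simp only [CartanMatrix.C, Matrix.of_apply, Fin.ext_iff]
          split_ifs <;> first | rfl | omega
      rcases hA.exists_extension hf ht hx hi hxi with h | h | h | h
      · exact (hB h).elim
      · exact (hD h).elim
      · exact (hG h).elim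
      · exact h
  obtain ⟨t, f, ht, hf⟩ := step (Fintype.card I)
  have hinj : Function.Injective (fun k : Fin (Fintype.card I + 1) ↦ f k) := by
    intro i j hij
    by_contra hne
    exact hA.chain_injective hf ht i.2 j.2 (fun h ↦ hne (Fin.ext h)) hij
  have := Fintype.card_le_of_injective _ hinj
  simp at this

end IsFiniteCartan

open RootPairing in
theorem isFiniteCartan_cartanMatrix {ι M N : Type*} [Finite ι] [AddCommGroup M] [Module ℝ M]
    [AddCommGroup N] [Module ℝ N] {P : RootPairing ι ℝ M N} [P.IsRootSystem] [P.IsCrystallographic]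
    (b : P.Base) [DecidableEq b.support] : IsFiniteCartan b.cartanMatrix where
  diag := b.cartanMatrix_apply_same
  nonpos := b.cartanMatrix_le_zero_of_ne
  zero_symm _ _ := b.cartanMatrix_apply_eq_zero_iff_symm.1
  posDef := by
    classical
    convert b.exists_cartanMatrix_diagaonal_mul_posDef

theorem exists_subdiagram {ι M N : Type*} [Finite ι] [AddCommGroup M] [Module ℝ M]
    [AddCommGroup N] [Module ℝ N] {P : RootPairing ι ℝ M N} [P.IsRootSystem] [P.IsCrystallographic]
    [P.IsReduced] [P.IsIrreducible] (b : P.Base)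
    (hA : ¬ ∃ n, HasDynkinType b (CartanMatrix.A n))
    (hC : ¬ ∃ n, HasDynkinType b (CartanMatrix.C n)) :
    HasSubdiagram b.cartanMatrix cartanB3 ∨ HasSubdiagram b.cartanMatrix cartanD4 ∨
      HasSubdiagram b.cartanMatrix cartanG2 := by
  classical
  have hne : Nonempty b.support := by
    by_contra hempty
    rw [not_nonempty_iff] at hempty
    have := RootPairing.IsIrreducible.nontrivial P
    have h0 := b.toWeightBasis.repr.toEquiv.subsingleton
    exact not_subsingleton M h0
  rcases (isFiniteCartan_cartanMatrix b).exists_subdiagram_or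
    (fun p i j hi h ↦ b.induction_on_cartanMatrix p hi h) with h | h | h | h | h
  · exact Or.inl h
  · exact Or.inr (Or.inl h)
  · exact Or.inr (Or.inr h)
  · exact (hA h).elim
  · exact (hC h).elim

/-! ### Reflection groups in which only `±1` is congruent to `1` modulo `2` -/

section Congruence

variable {l : ℕ}

theorem transpose_mul_mul_of_list {C G : Matrix (Fin l) (Fin l) ℤ}
    (hG : ∀ k, (simpleReflectionMatrix C k).transpose * G * simpleReflectionMatrix C k = G)
    (s : List (Fin l)) :
    (s.map (simpleReflectionMatrix C)).prod.transpose * G *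
      (s.map (simpleReflectionMatrix C)).prod = G := by
  induction s with
  | nil => simp
  | cons k s ih =>
    rw [List.map_cons, List.prod_cons, Matrix.transpose_mul]
    calc _ = (s.map (simpleReflectionMatrix C)).prod.transpose *
          ((simpleReflectionMatrix C k).transpose * G * simpleReflectionMatrix C k) *
          (s.map (simpleReflectionMatrix C)).prod := by simp only [Matrix.mul_assoc]
      _ = G := by rw [hG, ih]

open Matrix in
/-- An isometry of an even positive definite lattice generated by a connected system of vectors of
norm two is `±1` if it is congruent to `1` modulo `2`. -/
theorem eq_one_or_neg_one_of_congruent {G V V' m : Matrix (Fin (l + 1)) (Fin (l + 1)) ℤ}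
    (hsymm : G.transpose = G)
    (hpos : ∀ x : Fin (l + 1) → ℤ, ∃ r, 0 ≤ r ∧ x ⬝ᵥ G *ᵥ x = 2 * r ∧ (r = 0 → x = 0))
    (hV : ∀ i, V i ⬝ᵥ G *ᵥ V i = 2) (hV0 : ∀ i, V 0 ⬝ᵥ G *ᵥ V i ≠ 0) (hVV' : V' * V = 1)
    (hm : m.transpose * G * m = G) (hm2 : ∀ i j, 2 ∣ (m - 1) i j) : m = 1 ∨ m = -1 := by
  have hcomm : ∀ x y : Fin (l + 1) → ℤ, x ⬝ᵥ G *ᵥ y = y ⬝ᵥ G *ᵥ x := by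
    intro x y
    rw [dotProduct_mulVec, ← mulVec_transpose, hsymm, dotProduct_comm]
  have hinv : ∀ x y : Fin (l + 1) → ℤ, (m *ᵥ x) ⬝ᵥ G *ᵥ (m *ᵥ y) = x ⬝ᵥ G *ᵥ y := by
    intro x y
    conv_rhs => rw [← hm]
    rw [← mulVec_mulVec, ← mulVec_mulVec, dotProduct_mulVec x, vecMul_transpose]
  choose n hn using hm2
  have hmn : ∀ x, m *ᵥ x = x + (2 : ℤ) • (Matrix.of n *ᵥ x) := by
    intro x
    have : m = 1 + (2 : ℤ) • Matrix.of n := by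
      ext i j
      have := hn i j
      simp only [Matrix.sub_apply] at this
      simp only [Matrix.add_apply, Matrix.smul_apply, Matrix.of_apply, smul_eq_mul]
      linarith
    conv_lhs => rw [this]
    rw [add_mulVec, one_mulVec, smul_mulVec]
  -- Write `m v = v + 2u` with `v` of norm 2. Invariance of the norm gives `(v, u) = -(u, u)`, so
  -- the norms of `u` and `v + u` add up to 2. Both are even and nonnegative, so `u = 0` or `u =
  -- -v`.
  have hsign : ∀ i, m *ᵥ V i = V i ∨ m *ᵥ V i = -V i := by
    intro i
    set u := Matrix.of n *ᵥ V i with hu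
    have h1 := hinv (V i) (V i)
    rw [hmn (V i), ← hu] at h1
    simp only [mulVec_add, mulVec_smul, dotProduct_add, add_dotProduct, smul_dotProduct,
      dotProduct_smul, smul_eq_mul, hcomm u (V i), hV] at h1
    obtain ⟨r, hr, hur, hr0⟩ := hpos u
    obtain ⟨s, hs, hvs, hs0⟩ := hpos (V i + u)
    have h2 := hvs
    simp only [mulVec_add, dotProduct_add, add_dotProduct, hcomm u (V i), hV] at h2
    have hrs : r + s = 1 := by linarith
    have hcases : r = 0 ∨ s = 0 := by omega
    rcases hcases with h | h
    · left
      rw [hmn, ← hu, hr0 h, smul_zero, add_zero]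
    · right
      have : u = -V i := eq_neg_of_add_eq_zero_right (hs0 h)
      rw [hmn, ← hu, this]
      module
  -- The signs agree because `V 0` is not orthogonal to any `V i`.
  have hconn : ∀ i, ∀ ε : ℤ, m *ᵥ V 0 = ε • V 0 → ε ^ 2 = 1 → m *ᵥ V i = ε • V i := by
    intro i ε h0 hε
    have h1 := hinv (V 0) (V i)
    rcases sq_eq_one_iff.1 hε with rfl | rfl
    · rcases hsign i with h | h
      · rw [h, one_smul]
      · rw [h0, h, one_smul, mulVec_neg, dotProduct_neg] at h1
        exact absurd (by linarith) (hV0 i)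
    · rcases hsign i with h | h
      · rw [h0, h, neg_smul, one_smul, neg_dotProduct] at h1
        exact absurd (by linarith) (hV0 i)
      · rw [h, neg_smul, one_smul]
  -- The left inverse `V'` makes the rows of `V` a basis.
  have hfin : ∀ ε : ℤ, (∀ i, m *ᵥ V i = ε • V i) → m = ε • 1 := by
    intro ε h
    have h1 : V * m.transpose = ε • V := by
      ext i j
      have := congrFun (h i) j
      rw [Matrix.smul_apply, ← Pi.smul_apply (i := j), ← this]
      simp [mul_apply, mulVec, dotProduct, mul_comm]
    have h2 : m.transpose = ε • 1 := by
      rw [← one_mul m.transpose, ← hVV', Matrix.mul_assoc, h1, Matrix.mul_smul, hVV']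
    rw [← transpose_transpose m, h2, transpose_smul, transpose_one]
  rcases hsign 0 with h | h
  · left
    simpa using hfin 1 fun i ↦ hconn i 1 (by simpa using h) (by norm_num)
  · right
    simpa using hfin (-1) fun i ↦ hconn i (-1) (by simpa using h) (by norm_num)

/-- The reflection group with Cartan matrix `C` contains `-1`, and its only elements congruent
to `1` modulo `2` are `±1`. -/
structure HasSignCongruence (C : Matrix (Fin l) (Fin l) ℤ) : Prop where
  neg_one : ∃ s : List (Fin l), (s.map (simpleReflectionMatrix C)).prod = -1
  congruent : ∀ s : List (Fin l),
    (∀ i j, 2 ∣ ((s.map (simpleReflectionMatrix C)).prod - 1) i j) →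
    (s.map (simpleReflectionMatrix C)).prod = 1 ∨ (s.map (simpleReflectionMatrix C)).prod = -1

/-- The word for `-1` is the cube of a Coxeter element, the Coxeter number being 6, as for `D₄` and
`G₂`. `G` is the symmetrized Cartan matrix; its third basis vector has norm 4 and is replaced in `V`
by its sum with the second, of norm 2. -/
theorem hasSignCongruence_cartanB3 : HasSignCongruence cartanB3 where
  neg_one := ⟨[0, 1, 2, 0, 1, 2, 0, 1, 2], by decide⟩
  congruent s := by
    refine eq_one_or_neg_one_of_congruent (G := !![2, -1, 0; -1, 2, -2; 0, -2, 4])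
      (V := !![1, 0, 0; 0, 1, 0; 0, 1, 1]) (V' := !![1, 0, 0; 0, 1, 0; 0, -1, 1]) (by decide)
      (fun x ↦ ⟨x 0 ^ 2 - x 0 * x 1 + x 1 ^ 2 - 2 * x 1 * x 2 + 2 * x 2 ^ 2, ?_, ?_, ?_⟩)
      (by decide) (by decide) (by decide) (transpose_mul_mul_of_list (by decide) s)
    · nlinarith [sq_nonneg (x 0), sq_nonneg (x 0 - x 1), sq_nonneg (x 1 - 2 * x 2)]
    · simp [dotProduct, Matrix.mulVec, Fin.sum_univ_succ]
      ring
    · intro h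
      have h0 : x 0 = 0 := by
        nlinarith [sq_nonneg (x 0), sq_nonneg (x 0 - x 1), sq_nonneg (x 1 - 2 * x 2)]
      have h1 : x 1 = 0 := by
        rw [h0] at h
        nlinarith [sq_nonneg (x 1), sq_nonneg (x 1 - 2 * x 2)]
      have h2 : x 2 = 0 := by
        rw [h0, h1] at h
        nlinarith [sq_nonneg (x 2)]
      ext i
      fin_cases i <;> assumption

/-- The basis `V` lists the central vertex first, since it alone pairs nontrivially with every
other. -/
theorem hasSignCongruence_cartanD4 : HasSignCongruence cartanD4 where
  neg_one := ⟨[0, 1, 2, 3, 0, 1, 2, 3, 0, 1, 2, 3], by decide⟩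
  congruent s := by
    refine eq_one_or_neg_one_of_congruent (G := cartanD4)
      (V := !![0, 1, 0, 0; 1, 0, 0, 0; 0, 0, 1, 0; 0, 0, 0, 1])
      (V' := !![0, 1, 0, 0; 1, 0, 0, 0; 0, 0, 1, 0; 0, 0, 0, 1]) (by decide)
      (fun x ↦ ⟨x 0 ^ 2 + x 1 ^ 2 + x 2 ^ 2 + x 3 ^ 2 - x 0 * x 1 - x 1 * x 2 - x 1 * x 3,
        ?_, ?_, ?_⟩)
      (by decide) (by decide) (by decide) (transpose_mul_mul_of_list (by decide) s)
    · nlinarith [sq_nonneg (2 * x 0 - x 1), sq_nonneg (2 * x 2 - x 1), sq_nonneg (2 * x 3 - x 1),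
        sq_nonneg (x 1)]
    · simp [cartanD4, dotProduct, Matrix.mulVec, Fin.sum_univ_succ]
      ring
    · intro h
      have h1 : x 1 = 0 := by
        nlinarith [sq_nonneg (2 * x 0 - x 1), sq_nonneg (2 * x 2 - x 1),
          sq_nonneg (2 * x 3 - x 1), sq_nonneg (x 1)]
      rw [h1] at h
      have h0 : x 0 = 0 := by nlinarith [sq_nonneg (x 0), sq_nonneg (x 2), sq_nonneg (x 3)]
      have h2 : x 2 = 0 := by nlinarith [sq_nonneg (x 0), sq_nonneg (x 2), sq_nonneg (x 3)]
      have h3 : x 3 = 0 := by nlinarith [sq_nonneg (x 0), sq_nonneg (x 2), sq_nonneg (x 3)]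
      ext i
      fin_cases i <;> assumption

/-- The second basis vector has norm 6; its sum with the first has norm 2. -/
theorem hasSignCongruence_cartanG2 : HasSignCongruence cartanG2 where
  neg_one := ⟨[0, 1, 0, 1, 0, 1], by decide⟩
  congruent s := by
    refine eq_one_or_neg_one_of_congruent (G := !![2, -3; -3, 6])
      (V := !![1, 0; 1, 1]) (V' := !![1, 0; -1, 1]) (by decide)
      (fun x ↦ ⟨x 0 ^ 2 - 3 * x 0 * x 1 + 3 * x 1 ^ 2, ?_, ?_, ?_⟩)
      (by decide) (by decide) (by decide) (transpose_mul_mul_of_list (by decide) s)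
    · nlinarith [sq_nonneg (2 * x 0 - 3 * x 1), sq_nonneg (x 1)]
    · simp [dotProduct, Matrix.mulVec, Fin.sum_univ_succ]
      ring
    · intro h
      have h1 : x 1 = 0 := by nlinarith [sq_nonneg (2 * x 0 - 3 * x 1), sq_nonneg (x 1)]
      rw [h1] at h
      have h0 : x 0 = 0 := by nlinarith [sq_nonneg (x 0)]
      ext i
      fin_cases i <;> assumption

end Congruence

/-! ### Points modeled on the quotient by `±1` -/

section SignQuotient

open RootPairing

/-- A tuple of halves of part of a basis of `L` detects congruences modulo `2`. -/
theorem exists_half_period (L : Submodule ℤ C2) [DiscreteTopology L] [IsZLattice ℝ L] {l : ℕ}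
    (hl : l ≤ 4) : ∃ z : Fin l → C2, (∀ i, (-z - z) i ∈ L) ∧
      ∀ m : Matrix (Fin l) (Fin l) ℤ, (∀ i, (matAct m z - z) i ∈ L) →
        ∀ i j, 2 ∣ (m - 1) i j := by
  have := ZLattice.module_finite ℝ L
  have := ZLattice.module_free ℝ L
  -- The real dimension of `ℂ²`; this is the source of the bound `l ≤ 4`.
  have hrank : Module.finrank ℤ L = 4 := by
    rw [ZLattice.rank ℝ L, ← Module.finrank_mul_finrank ℝ ℂ C2]
    simp
  let c := Module.finBasisOfFinrankEq ℤ L hrank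
  have hz : ∀ i, (2 : ℤ) • (2⁻¹ : ℝ) • (c (Fin.castLE hl i) : C2) = c (Fin.castLE hl i) := by
    intro i
    rw [← Int.cast_smul_eq_zsmul ℝ, smul_smul]
    norm_num
  refine ⟨fun i ↦ (2⁻¹ : ℝ) • (c (Fin.castLE hl i) : C2), fun i ↦ ?_, fun m hm i j ↦ ?_⟩
  · have h : -((2⁻¹ : ℝ) • (c (Fin.castLE hl i) : C2)) - (2⁻¹ : ℝ) • (c (Fin.castLE hl i) : C2) =
        -(c (Fin.castLE hl i) : C2) := by
      rw [← neg_add', ← two_smul ℤ, hz]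
    rw [Pi.sub_apply, Pi.neg_apply, h]
    exact neg_mem (c _).2
  -- Twice the lattice vector `(m z - z) i` has the entries of row `i` of `m - 1` as coordinates, so
  -- these entries are even.
  · have h1 : (2 : ℤ) • (⟨_, hm i⟩ : L) = ∑ j, (m - 1) i j • c (Fin.castLE hl j) := by
      apply Subtype.ext
      rw [Submodule.coe_smul, Submodule.coe_sum]
      have h2 : (matAct m (fun i ↦ (2⁻¹ : ℝ) • (c (Fin.castLE hl i) : C2)) -
          fun i ↦ (2⁻¹ : ℝ) • (c (Fin.castLE hl i) : C2)) i =
          ∑ j, (m - 1) i j • (2⁻¹ : ℝ) • (c (Fin.castLE hl j) : C2) := by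
        simp [matAct_apply, sub_smul, Matrix.one_apply]
      refine (congrArg ((2 : ℤ) • ·) h2).trans ?_
      rw [Finset.smul_sum]
      refine Finset.sum_congr rfl fun j _ ↦ ?_
      rw [smul_comm, hz, Submodule.coe_smul]
    refine ⟨c.repr ⟨_, hm i⟩ (Fin.castLE hl j), ?_⟩
    have h3 := congrArg (fun x ↦ c.repr x (Fin.castLE hl j)) h1
    simp only [map_smul, Finsupp.smul_apply, map_sum, Finsupp.coe_finsetSum, Finset.sum_apply,
      Module.Basis.repr_self, smul_eq_mul] at h3
    rw [h3, Finset.sum_eq_single j]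
    · simp
    · intro k _ hk
      rw [Finsupp.single_eq_of_ne, mul_zero]
      exact fun h ↦ hk (Fin.castLE_injective hl h).symm
    · simp

variable {ι M N : Type*} [Finite ι] [AddCommGroup M] [Module ℝ M] [AddCommGroup N] [Module ℝ N]
  {P : RootPairing ι ℝ M N} [P.IsRootSystem] [P.IsCrystallographic] [P.IsReduced] {b : P.Base}

/-- At the half-period `z` the stabilizer in the parabolic subgroup consists of the elements
congruent to 1 modulo 2, which act on the subdiagram's coroots as `±1`; a generic translation
removes all other stabilizing elements. -/
theorem exists_point_of_hasSubdiagram (L : Submodule ℤ C2) [DiscreteTopology L] [IsZLattice ℝ L]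
    {l : ℕ} (hl : l ≤ 4) {C : Matrix (Fin l) (Fin l) ℤ} (hC : HasSignCongruence C)
    (hsub : HasSubdiagram b.cartanMatrix C) :
    ∃ (k : ℕ) (p : (C2 ⧸ L) ⊗[ℤ] CorootLattice P), b.support.card = l + k ∧
      (torusQuotient L b).LocallyModeledOn (Quotient.mk _ p)
        (AnalyticStructure.quotientProd (signQuotientMap l) (Fin k → C2)) (Quotient.mk _ 0, 0) := by
  classical
  obtain ⟨e, he⟩ := hsub
  obtain rfl : b.cartanMatrix.submatrix e e = C := Matrix.ext he
  obtain ⟨k, hk⟩ : ∃ k, b.support.card = l + k := by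
    refine Nat.exists_eq_add_of_le ?_
    simpa using Fintype.card_le_of_embedding e
  obtain ⟨z, hz, hz2⟩ := exists_half_period L hl
  obtain ⟨f, -, hstab⟩ := exists_translate_stabilizer b e L (matAct (embedMatrix e) z)
  obtain ⟨B, κ, hκ, hB⟩ := exists_parabolicEquiv e (k := k) (by simp [hk])
  refine ⟨k, tensorCoord L.mkQ b (matAct (embedMatrix e) z + f), hk, ?_⟩
  rw [quotientProd_eq_quotient (isHolQuotientMap_signQuotientMap l)]
  refine torusQuotient_locallyModeledOn L b _ (isHolQuotientMap_signQuotientMap l).prodMap B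
    fun u v ↦ ?_
  rw [Prod.map_apply', Prod.map_apply', Prod.mk.injEq, signQuotientMap_eq_iff]
  constructor
  · rintro ⟨h | h, h'⟩
    · refine ⟨1, one_smul _ _, ?_⟩
      rw [map_one, matAct_one]
      exact congrArg B (Prod.ext h h')
    · obtain ⟨s, hs⟩ := hC.neg_one
      have hm := weylMatrix_list_prod_mul_embedMatrix b e s
      rw [hs] at hm
      have hw : (s.map fun j ↦ weylGroup.ofIdx P (e j : ι)).prod ∈ parabolicSubgroup b e := by
        refine Subgroup.list_prod_mem _ fun x hx ↦ ?_
        obtain ⟨j, -, rfl⟩ := List.mem_map.1 hx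
        exact ofIdx_mem_parabolicSubgroup b j
      refine ⟨_, (hstab _).2 ⟨hw, (smul_tensorCoord_embed_eq_iff L hm z).2 ?_⟩, ?_⟩
      · rwa [matAct_neg_one]
      · rw [matAct_parabolicEquiv hκ hB hw hm, matAct_neg_one]
        exact congrArg B (Prod.ext h h')
  · rintro ⟨w, hw, huv⟩
    obtain ⟨hw, hwz⟩ := (hstab w).1 hw
    obtain ⟨s, rfl⟩ := exists_list_of_mem_parabolicSubgroup hw
    have hm := weylMatrix_list_prod_mul_embedMatrix b e s
    have hcong := hC.congruent s (hz2 _ ((smul_tensorCoord_embed_eq_iff L hm z).1 hwz))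
    rw [matAct_parabolicEquiv hκ hB hw hm] at huv
    have h := B.injective huv
    have h1 := (Prod.ext_iff.1 h).1
    refine ⟨?_, (Prod.ext_iff.1 h).2⟩
    rcases hcong with hc | hc
    · left
      rwa [hc, matAct_one] at h1
    · right
      rwa [hc, matAct_neg_one] at h1

theorem exists_point_of_not_hasDynkinType [P.IsIrreducible] (L : Submodule ℤ C2)
    [DiscreteTopology L] [IsZLattice ℝ L] (hA : ¬ ∃ n, HasDynkinType b (CartanMatrix.A n))
    (hC : ¬ ∃ n, HasDynkinType b (CartanMatrix.C n)) :
    ∃ (l k : ℕ) (p : (C2 ⧸ L) ⊗[ℤ] CorootLattice P), 1 < l ∧ b.support.card = l + k ∧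
      (torusQuotient L b).LocallyModeledOn (Quotient.mk _ p)
        (AnalyticStructure.quotientProd (signQuotientMap l) (Fin k → C2)) (Quotient.mk _ 0, 0) := by
  rcases exists_subdiagram b hA hC with h | h | h
  · obtain ⟨k, p, hk, hp⟩ :=
      exists_point_of_hasSubdiagram L (by norm_num) hasSignCongruence_cartanB3 h
    exact ⟨3, k, p, by norm_num, hk, hp⟩
  · obtain ⟨k, p, hk, hp⟩ :=
      exists_point_of_hasSubdiagram L (by norm_num) hasSignCongruence_cartanD4 h
    exact ⟨4, k, p, by norm_num, hk, hp⟩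
  · obtain ⟨k, p, hk, hp⟩ :=
      exists_point_of_hasSubdiagram L (by norm_num) hasSignCongruence_cartanG2 h
    exact ⟨2, k, p, by norm_num, hk, hp⟩

end SignQuotient

end

theorem mainTheorem10
    (L : Submodule ℤ C2) [DiscreteTopology L] [IsZLattice ℝ L] :
    (∀ (ι : Type*) (M : Type*) (N : Type*) (ι' : Type*) (M' : Type*) (N' : Type*)
      [Finite ι] [AddCommGroup M] [Module ℝ M] [AddCommGroup N] [Module ℝ N]
      [Finite ι'] [AddCommGroup M'] [Module ℝ M'] [AddCommGroup N'] [Module ℝ N']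
      (P : RootPairing ι ℝ M N) [P.IsRootSystem] [P.IsCrystallographic] [P.IsReduced]
      (P' : RootPairing ι' ℝ M' N') [P'.IsRootSystem] [P'.IsCrystallographic] [P'.IsReduced]
      (b : P.Base) (b' : P'.Base) (_ : DynkinInclusion b b')
      (l k : ℕ) (_ : b.support.card = l) (_ : b'.support.card = l + k)
      (p : (C2 ⧸ L) ⊗[ℤ] CorootLattice P),
      ∃ p' : (C2 ⧸ L) ⊗[ℤ] CorootLattice P',
        Nonempty (MulAction.stabilizer P'.weylGroup p' ≃* MulAction.stabilizer P.weylGroup p) ∧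
        (torusQuotient L b').LocallyModeledOn (Quotient.mk _ p')
          (AnalyticStructure.quotientProd
            (linearQuotientMap b (MulAction.stabilizer P.weylGroup p)) (Fin k → C2))
          (Quotient.mk _ 0, 0)) ∧
    (∀ (ι : Type*) (M : Type*) (N : Type*)
      [Finite ι] [AddCommGroup M] [Module ℝ M] [AddCommGroup N] [Module ℝ N]
      (P : RootPairing ι ℝ M N) [P.IsRootSystem] [P.IsCrystallographic] [P.IsReduced]
      [P.IsIrreducible] (b : P.Base),
      (¬ ∃ n, HasDynkinType b (CartanMatrix.A n)) →
      (¬ ∃ n, HasDynkinType b (CartanMatrix.C n)) →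
      ∃ (l k : ℕ) (p : (C2 ⧸ L) ⊗[ℤ] CorootLattice P), 1 < l ∧ b.support.card = l + k ∧
        (torusQuotient L b).LocallyModeledOn (Quotient.mk _ p)
          (AnalyticStructure.quotientProd (signQuotientMap l) (Fin k → C2))
          (Quotient.mk _ 0, 0)) :=
  ⟨fun _ _ _ _ _ _ _ _ _ _ _ _ _ _ _ _ _ _ _ _ _ _ _ _ _ _ D l k hl hk p ↦
    exists_point_of_dynkinInclusion L D l k hl hk p,
  fun _ _ _ _ _ _ _ _ _ _ _ _ _ _ hA hC ↦ exists_point_of_not_hasDynkinType L hA hC⟩
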